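/- **Setting.** Normalize units by the gravitational parameter. A non-degenerate elliptic Keplerian orbit around the origin is encoded by a pair $(\vec l,\vec s)$ of vectors of $\mathbb R^3$ with $\vec l\cdot\vec s=0$, $\vec l\ne 0$, $|\vec s|<|\vec l|$; in a unit direction $\hat r\perp\vec l$ the inverse distance to the origin is $|\vec l|^2+(\vec s\times\vec l)\cdot\hat r$ and the velocity is $\vec w=\vec s+\vec l\times\hat r$. Let $l_{0z},l_{2z}$ be nonzero reals of arbitrary sign. A *transfer* is a triple $(\vec l_1,\vec s_1,\hat r_1)$, $\hat r_1=(x_1,y_1,z_1)$, $|\hat r_1|=1$, such that, with $\vec l_0=(0,0,l_{0z})$, $\vec l_2=(0,0,l_{2z})$, $\vec s_0=\vec s_2=0$, $\hat r_0=(1,0,0)$, each $(\vec l_i,\vec s_i)$ is an orbit as above, and for $i=0,1$ one has $\hat r_i\perp\vec l_i$, $\hat r_i\perp\vec l_{i+1}$, and the orbits $i$ and $i+1$ have the same distance to the origin in the direction $\hat r_i$. Its cost is $f_1=\Delta_0+\Delta_1$, where $\Delta_i=|(\vec s_i+\vec l_i\times\hat r_i)-(\vec s_{i+1}+\vec l_{i+1}\times\hat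 r_i)|$. Thus transfers are the 2-impulse transfers between two concentric coplanar circular orbits, with an intermediate orbit that may leave the plane. A *critical point* of a polynomial $q$ on a real variety $q_1=\dots=q_m=0$ is a point of the variety at which $\nabla q_1,\dots,\nabla q_m$ are linearly dependent or $\nabla q=\sum\lambda_i\nabla q_i$ for some real $\lambda_i$. **Statement.** 1. For every transfer $l_{1x}=0$, $z_1=0$ and $l_{1y}y_1=0$. If $l_{1y}=0$, then $s_{1z}=0$. If $l_{1y}\ne0$, then $\hat r_1=(\pm1,0,0)$, and $\hat r_1=(1,0,0)$ is possible only if $l_{0z}^2=l_{2z}^2$. 2. (Coplanar critical points.) Let $l_{0z}^2\neq l_{2z}^2$. A transfer with $l_{1y}=0$ is a critical point of $\Delta_0+\Delta_1$ in the variables $s_{1x},s_{1y},l_{1z},x_1,y_1,\Delta_0,\Delta_1$ (with $\Delta_0,\Delta_1$ the magnitudes of the impulses) on the variety $$x_1^2+y_1^2=1,\quad l_{0z}^2=l_{1z}^2+s_{1y}l_{1z},\quad l_{2z}^2=l_{1z}^2+x_1s_{1y}l_{1z}-y_1s_{1x}l_{1z},$$ $$\Delta_0^2=s_{1x}^2+(s_{1y}+l_{1z}-l_{0z})^2,\quad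 \Delta_1^2=(s_{1x}-l_{1z}y_1+l_{2z}y_1)^2+(s_{1y}+l_{1z}x_1-l_{2z}x_1)^2$$ if and only if it is one of the two triples $$H_\pm:\quad x_1=-1,\ y_1=0,\ l_{1z}=\pm\sqrt{\tfrac{l_{0z}^2+l_{2z}^2}{2}},\ s_{1x}=0,\ s_{1y}=\tfrac{l_{0z}^2-l_{2z}^2}{l_{0z}^2+l_{2z}^2}\,l_{1z},$$ with $l_{1x}=l_{1y}=s_{1z}=z_1=0$. 3. For all nonzero $l_{0z},l_{2z}$, the triples $H_\pm$ are transfers, and $f_1(H_\pm)=C_\pm$, where $$C_\pm=\left|\frac{\pm\sqrt2\,l_{0z}^2}{\sqrt{l_{0z}^2+l_{2z}^2}}-l_{0z}\right|+\left|\frac{\pm\sqrt2\,l_{2z}^2}{\sqrt{l_{0z}^2+l_{2z}^2}}-l_{2z}\right|.$$ 4. (Optimality of the Hohmann transfer.) Let $\varepsilon=\pm1$ be a sign with $\varepsilon(l_{0z}+l_{2z})\ge0$ (either sign if $l_{0z}+l_{2z}=0$). Then $H_\varepsilon$ minimizes $f_1$ among all transfers, coplanar or not; if $l_{0z}^2\ne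 l_{2z}^2$ it is the only minimizer; and every transfer with $l_{1y}\neq0$ has cost strictly greater than $C_\varepsilon$. If $\varepsilon(l_{0z}+l_{2z})>0$, then $C_\varepsilon<C_{-\varepsilon}$. 5. (Non-coplanar critical points.) A transfer with $l_{1y}\ne0$ and $\hat r_1=(-1,0,0)$ is a critical point of $\Delta_0+\Delta_1$ in the variables $s_{1x},s_{1y},s_{1z},l_{1y},l_{1z},\Delta_0,\Delta_1$ (again with $\Delta_0,\Delta_1$ the magnitudes of the impulses) on the variety $$l_{1y}s_{1y}+l_{1z}s_{1z}=0,\quad l_{0z}^2=l_{1y}^2+l_{1z}^2+s_{1y}l_{1z}-s_{1z}l_{1y},\quad l_{2z}^2=l_{1y}^2+l_{1z}^2-s_{1y}l_{1z}+s_{1z}l_{1y},$$ $$\Delta_0^2=s_{1x}^2+(s_{1y}+l_{1z}-l_{0z})^2+(s_{1z}-l_{1y})^2,\quad \Delta_1^2=s_{1x}^2+(s_{1y}-l_{1z}+l_{2z})^2+(s_{1z}+l_{1y})^2$$ if and only if (with $l_{1x}=0$) $$l_{1z}=\frac{l_{0z}^5+l_{0z}^4l_{2z}+4l_{0z}^3l_{2z}^2+4l_{0z}^2l_{2z}^3+l_{0z}l_{2z}^4+l_{2z}^5}{4l_{0z}l_{2z}(l_{0z}^2+l_{0z}l_{2z}+l_{2z}^2)},\quad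 l_{1y}=\pm\sqrt{\tfrac{l_{0z}^2+l_{2z}^2}{2}-l_{1z}^2},$$ $$s_{1x}=0,\quad s_{1y}=\tfrac{l_{0z}^2-l_{2z}^2}{l_{0z}^2+l_{2z}^2}\,l_{1z},\quad s_{1z}=-\tfrac{l_{0z}^2-l_{2z}^2}{l_{0z}^2+l_{2z}^2}\,l_{1y}.$$ The polynomial $t^4+2t^3+2t+1$ has exactly two real roots $a_1<a_2$, both negative, and such critical points exist if and only if $a_1<l_{2z}/l_{0z}<a_2$; in that case the radicand above is positive. 6. (Equal radii.) If $l_{0z}=l_{2z}$, the minimal cost is $0$. If $l_{0z}=-l_{2z}$, the minimal cost is $2|l_{0z}|$, and it is attained by infinitely many transfers with $\hat r_1=\hat r_0=(1,0,0)$, namely exactly by those with $\vec l_1=(0,0,l_{0z}/\tau)$ and $\vec s_1=(0,\tau l_{0z}-l_{0z}/\tau,0)$, where $0<|\tau|\le1$. -/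

import Mathlib

open scoped Matrix

noncomputable section

namespace OrbitTransfer

/-- Vectors of three-dimensional space, as triples of coordinates `0, 1, 2` (that is, `x, y, z`). -/
abbrev Vec : Type := Fin 3 → ℝ

/-- The Euclidean length of a vector. -/
def len (v : Vec) : ℝ := ‖WithLp.toLp 2 v‖

/-- The (normalized) velocity `w = s + l × r̂` on the Keplerian orbit `(l, s)` in the direction
`r̂`. -/
def velocity (l s r : Vec) : Vec := s + l ⨯₃ r

/-- The inverse `1 / |r|` of the distance to the centre on the orbit `(l, s)` in the direction
`r̂`. -/
def invRadius (l s r : Vec) : ℝ := l ⬝ᵥ l + (s ⨯₃ l) ⬝ᵥ r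

/-- The vectors `l₀, …, lₙ`, `s₀, …, sₙ`, `r̂₀, …, r̂ₙ₋₁` represent an `n`-impulse transfer:
`(lᵢ, sᵢ)` is a non-degenerate elliptic orbit, and the `i`-th and `(i+1)`-st orbits meet in the
direction `r̂ᵢ`, where the `i`-th impulse is applied. -/
structure IsTransfer (n : ℕ) (l s : Fin (n + 1) → Vec) (r : Fin n → Vec) : Prop where
  orthogonal : ∀ i, l i ⬝ᵥ s i = 0
  nondegenerate : ∀ i, l i ≠ 0
  elliptic : ∀ i, len (s i) < len (l i)
  plane_before : ∀ i : Fin n, l i.castSucc ⬝ᵥ r i = 0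
  plane_after : ∀ i : Fin n, l i.succ ⬝ᵥ r i = 0
  unit : ∀ i, len (r i) ^ 2 = 1
  same_point : ∀ i : Fin n,
    invRadius (l i.castSucc) (s i.castSucc) (r i) = invRadius (l i.succ) (s i.succ) (r i)

/-- The magnitude `Δᵢ = |wᵢ - wᵢ*|` of the `i`-th impulse. -/
def impulse {n : ℕ} (l s : Fin (n + 1) → Vec) (r : Fin n → Vec) (i : Fin n) : ℝ :=
  len (velocity (l i.castSucc) (s i.castSucc) (r i) - velocity (l i.succ) (s i.succ) (r i))

/-- The total cost `f₁ = Δ₀ + ⋯ + Δₙ₋₁`. -/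
def cost {n : ℕ} (l s : Fin (n + 1) → Vec) (r : Fin n → Vec) : ℝ := ∑ i, impulse l s r i

/-- The unknowns `l₁`, `s₁` (the intermediate orbit) and `r̂₁` (the direction of the second impulse)
of a two-impulse transfer between two given orbits with given first point. -/
@[ext] structure Unknowns where
  l : Vec
  s : Vec
  r : Vec

/-- `l₀ = (0, 0, a)`, `l₁`, `l₂ = (0, 0, b)`. -/
def circL (a b : ℝ) (u : Unknowns) : Fin 3 → Vec := ![![0, 0, a], u.l, ![0, 0, b]]

/-- `s₀ = 0`, `s₁`, `s₂ = 0`. -/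
def circS (u : Unknowns) : Fin 3 → Vec := ![0, u.s, 0]

/-- `r̂₀ = (1, 0, 0)`, `r̂₁`. -/
def circR (u : Unknowns) : Fin 2 → Vec := ![![1, 0, 0], u.r]

/-- `u` is a two-impulse transfer between the circular orbits in the plane `z = 0` with
`l₀ = (0, 0, a)` and `l₂ = (0, 0, b)`, whose first impulse is applied on the positive `x`-axis. -/
def IsCircTransfer (a b : ℝ) (u : Unknowns) : Prop :=
  IsTransfer 2 (circL a b u) (circS u) (circR u)

/-- The magnitude of the first impulse. -/
def Δ₀ (a b : ℝ) (u : Unknowns) : ℝ := impulse (circL a b u) (circS u) (circR u) 0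

/-- The magnitude of the second impulse. -/
def Δ₁ (a b : ℝ) (u : Unknowns) : ℝ := impulse (circL a b u) (circS u) (circR u) 1

/-- The cost `f₁ = Δ₀ + Δ₁`. -/
def f₁ (a b : ℝ) (u : Unknowns) : ℝ := cost (circL a b u) (circS u) (circR u)

/-- The gradient of a real polynomial at a point. -/
def grad {k : ℕ} (q : MvPolynomial (Fin k) ℝ) (p : Fin k → ℝ) : Fin k → ℝ :=
  fun j => MvPolynomial.eval p (MvPolynomial.pderiv j q)

/-- `p` is a critical point of the polynomial `q` on the real variety `c₁ = ⋯ = cₘ = 0`: it lies on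
the variety, and either the gradients of the `cᵢ` at `p` are linearly dependent (a singular point),
or the Lagrange multiplier equation is solvable at `p`. -/
def IsCriticalPoint {k m : ℕ} (q : MvPolynomial (Fin k) ℝ) (c : Fin m → MvPolynomial (Fin k) ℝ)
    (p : Fin k → ℝ) : Prop :=
  (∀ i, MvPolynomial.eval p (c i) = 0) ∧
    (¬ LinearIndependent ℝ (fun i => grad (c i) p) ∨
      ∃ lam : Fin m → ℝ, grad q p = ∑ i, lam i • grad (c i) p)

/-- The cost `Δ₀ + Δ₁` as a polynomial; the variables `5` and `6` are `Δ₀` and `Δ₁`. -/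
def costPoly : MvPolynomial (Fin 7) ℝ := MvPolynomial.X 5 + MvPolynomial.X 6

/-- The equations of the coplanar case `l₁ = (0, 0, l₁z)`, `s₁ = (s₁x, s₁y, 0)`, `r̂₁ = (x₁, y₁, 0)`,
in the variables `s₁x, s₁y, l₁z, x₁, y₁, Δ₀, Δ₁`. -/
def coplanarEqs (a b : ℝ) : Fin 5 → MvPolynomial (Fin 7) ℝ :=
  let sx : MvPolynomial (Fin 7) ℝ := MvPolynomial.X 0
  let sy : MvPolynomial (Fin 7) ℝ := MvPolynomial.X 1
  let lz : MvPolynomial (Fin 7) ℝ := MvPolynomial.X 2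
  let x : MvPolynomial (Fin 7) ℝ := MvPolynomial.X 3
  let y : MvPolynomial (Fin 7) ℝ := MvPolynomial.X 4
  let d₀ : MvPolynomial (Fin 7) ℝ := MvPolynomial.X 5
  let d₁ : MvPolynomial (Fin 7) ℝ := MvPolynomial.X 6
  let A : MvPolynomial (Fin 7) ℝ := MvPolynomial.C a
  let B : MvPolynomial (Fin 7) ℝ := MvPolynomial.C b
  ![x ^ 2 + y ^ 2 - 1,
    lz ^ 2 + sy * lz - A ^ 2,
    lz ^ 2 + x * sy * lz - y * sx * lz - B ^ 2,
    d₀ ^ 2 - (sx ^ 2 + (sy + lz - A) ^ 2),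
    d₁ ^ 2 - ((sx - lz * y + B * y) ^ 2 + (sy + lz * x - B * x) ^ 2)]

/-- The values of the variables of `coplanarEqs` at a transfer. -/
def coplanarPoint (a b : ℝ) (u : Unknowns) : Fin 7 → ℝ :=
  ![u.s 0, u.s 1, u.l 2, u.r 0, u.r 1, Δ₀ a b u, Δ₁ a b u]

/-- The equations of the case `r̂₁ = (-1, 0, 0)`, `l₁ = (0, l₁y, l₁z)`, `s₁ = (s₁x, s₁y, s₁z)`, in the
variables `s₁x, s₁y, s₁z, l₁y, l₁z, Δ₀, Δ₁`. -/
def oppositeEqs (a b : ℝ) : Fin 5 → MvPolynomial (Fin 7) ℝ :=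
  let sx : MvPolynomial (Fin 7) ℝ := MvPolynomial.X 0
  let sy : MvPolynomial (Fin 7) ℝ := MvPolynomial.X 1
  let sz : MvPolynomial (Fin 7) ℝ := MvPolynomial.X 2
  let ly : MvPolynomial (Fin 7) ℝ := MvPolynomial.X 3
  let lz : MvPolynomial (Fin 7) ℝ := MvPolynomial.X 4
  let d₀ : MvPolynomial (Fin 7) ℝ := MvPolynomial.X 5
  let d₁ : MvPolynomial (Fin 7) ℝ := MvPolynomial.X 6
  let A : MvPolynomial (Fin 7) ℝ := MvPolynomial.C a
  let B : MvPolynomial (Fin 7) ℝ := MvPolynomial.C b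
  ![ly * sy + lz * sz,
    ly ^ 2 + lz ^ 2 + sy * lz - sz * ly - A ^ 2,
    ly ^ 2 + lz ^ 2 - sy * lz + sz * ly - B ^ 2,
    d₀ ^ 2 - (sx ^ 2 + (sy + lz - A) ^ 2 + (sz - ly) ^ 2),
    d₁ ^ 2 - (sx ^ 2 + (sy - lz + B) ^ 2 + (sz + ly) ^ 2)]

/-- The values of the variables of `oppositeEqs` at a transfer. -/
def oppositePoint (a b : ℝ) (u : Unknowns) : Fin 7 → ℝ :=
  ![u.s 0, u.s 1, u.s 2, u.l 1, u.l 2, Δ₀ a b u, Δ₁ a b u]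

/-- The transfer is a critical point of `f₁` among the coplanar transfers. -/
def IsCoplanarCritical (a b : ℝ) (u : Unknowns) : Prop :=
  IsCircTransfer a b u ∧ u.l 1 = 0 ∧
    IsCriticalPoint costPoly (coplanarEqs a b) (coplanarPoint a b u)

/-- The transfer is non-coplanar, with impulses at opposite sides of the centre, and is a critical
point of `f₁` among such transfers. -/
def IsOppositeCritical (a b : ℝ) (u : Unknowns) : Prop :=
  IsCircTransfer a b u ∧ u.l 1 ≠ 0 ∧ u.r = ![-1, 0, 0] ∧
    IsCriticalPoint costPoly (oppositeEqs a b) (oppositePoint a b u)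

/-- The candidate with `x₁ = -1`, `y₁ = 0`, `l₁z = ε √((a² + b²) / 2)`, `s₁x = 0` and
`s₁y = (a² - b²) / (a² + b²) * l₁z`; here `ε = ±1` is a sign. -/
def hohmann (a b ε : ℝ) : Unknowns where
  l := ![0, 0, ε * √((a ^ 2 + b ^ 2) / 2)]
  s := ![0, (a ^ 2 - b ^ 2) / (a ^ 2 + b ^ 2) * (ε * √((a ^ 2 + b ^ 2) / 2)), 0]
  r := ![-1, 0, 0]

/-- The value `|±√2 a² / √(a² + b²) - a| + |±√2 b² / √(a² + b²) - b|`. -/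
def hohmannCost (a b ε : ℝ) : ℝ :=
  |ε * √2 * a ^ 2 / √(a ^ 2 + b ^ 2) - a| + |ε * √2 * b ^ 2 / √(a ^ 2 + b ^ 2) - b|

/-- The value of `l₁z` at the non-coplanar critical points. -/
def oppositeLz (a b : ℝ) : ℝ :=
  (a ^ 5 + a ^ 4 * b + 4 * a ^ 3 * b ^ 2 + 4 * a ^ 2 * b ^ 3 + a * b ^ 4 + b ^ 5) /
    (4 * a * b * (a ^ 2 + a * b + b ^ 2))

/-- The non-coplanar candidate, with `l₁y = ε √((a² + b²) / 2 - l₁z²)`, where `ε = ±1`. -/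
def oppositeSol (a b ε : ℝ) : Unknowns where
  l := ![0, ε * √((a ^ 2 + b ^ 2) / 2 - oppositeLz a b ^ 2), oppositeLz a b]
  s := ![0, (a ^ 2 - b ^ 2) / (a ^ 2 + b ^ 2) * oppositeLz a b,
    -((a ^ 2 - b ^ 2) / (a ^ 2 + b ^ 2) * (ε * √((a ^ 2 + b ^ 2) / 2 - oppositeLz a b ^ 2)))]
  r := ![-1, 0, 0]

end OrbitTransfer

end

open scoped Matrix

namespace OrbitTransfer

/-! For a coplanar transfer put `w = 1 / l₁z`. The intermediate orbit has tangential velocities `a²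
w` and `b² w` at the two impulses, and its radial velocities `S`, `Q` there are tied by conservation
of energy, `S² + a⁴w² - 2a² = Q² + b⁴w² - 2b²`. With `Δ₀² = S² + (a²w - a)²` and `Δ₁² = Q² + (b²w -
b)²`, minimality becomes an inequality in `w, S, Q` (`hohmann_bound`): moving `w` away from the
Hohmann value raises the cost of the impulse at one circle by more than the other impulse can save.

A non-coplanar transfer has both impulses on the x-axis. If they lie on opposite sides of the
centre, `|l₁|` is fixed, and each squared impulse is at least the convex combination, with weights
`(1 ± z) / 2` given by the cosine `z` of the inclination, of the squared impulses of the two Hohmann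
candidates. Strict concavity of the square root puts the cost above a convex combination of `C₊` and
`C₋` (`hohmann_lt_opposite`), and `hohmann_sign` says which of these is smaller. If they lie at the
same point, then `a = ±b`, and the cost is compared directly with `0` or `2|a|`.

For critical points the multipliers are eliminated along symmetries. In the plane, rotating `r̂₁`
shows that the orbit is tangent to at least one circle, and the remaining equations then force `a² =
b²` except when `x₁ = -1`, `y₁ = s₁x = 0` (`coplanar_lagrange`). In the opposite case, rotating the
orbit about the x-axis gives `a³Δ₁ + b³Δ₀ = 0`. The squared impulses are affine in `l₁z`, so
squaring this relation leaves a linear equation for `l₁z`. Existence then amounts to `l₁y² > 0`,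
which is decided by the sign of a palindromic quartic in `b / a`. -/

/-! ### Transfers and impulses in coordinates. -/

lemma len_sq (v : Vec) : len v ^ 2 = v 0 ^ 2 + v 1 ^ 2 + v 2 ^ 2 := by
  simp [len, EuclideanSpace.norm_sq_eq, Fin.sum_univ_three]

lemma len_nonneg (v : Vec) : 0 ≤ len v := norm_nonneg _

lemma len_lt_len_iff (v w : Vec) :
    len v < len w ↔ v 0 ^ 2 + v 1 ^ 2 + v 2 ^ 2 < w 0 ^ 2 + w 1 ^ 2 + w 2 ^ 2 := by
  rw [← len_sq, ← len_sq, sq_lt_sq₀ (len_nonneg _) (len_nonneg _)]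

/-- The conditions of a transfer in coordinates. -/
lemma isCircTransfer_iff {a b : ℝ} (ha : a ≠ 0) (hb : b ≠ 0) (u : Unknowns) :
    IsCircTransfer a b u ↔ u.l 0 = 0 ∧ u.r 2 = 0 ∧ u.l 1 * u.r 1 = 0 ∧
      u.r 0 ^ 2 + u.r 1 ^ 2 = 1 ∧ u.l 1 * u.s 1 + u.l 2 * u.s 2 = 0 ∧
      u.s 0 ^ 2 + u.s 1 ^ 2 + u.s 2 ^ 2 < u.l 1 ^ 2 + u.l 2 ^ 2 ∧
      a ^ 2 = u.l 1 ^ 2 + u.l 2 ^ 2 + u.s 1 * u.l 2 - u.s 2 * u.l 1 ∧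
      b ^ 2 = u.l 1 ^ 2 + u.l 2 ^ 2 + (u.s 1 * u.l 2 - u.s 2 * u.l 1) * u.r 0
        - u.s 0 * u.l 2 * u.r 1 := by
  constructor
  · rintro ⟨h1, -, h3, h4, h5, h6, h7⟩
    have e1 := h1 1
    have e3 := h3 1
    have e4 := h4 1
    have e5 := h5 0
    have e6 := h6 1
    have e7 := h7 0
    have e8 := h7 1
    have e9 := h5 1
    rw [len_lt_len_iff] at e3
    rw [len_sq] at e6
    simp [circL, circS, circR, invRadius, cross_apply, Matrix.vec3_dotProduct, Matrix.vecHead,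
      Matrix.vecTail] at e1 e3 e4 e5 e6 e7 e8 e9
    have hr : u.r 2 = 0 := by tauto
    simp only [e5, hr] at e1 e3 e4 e6 e7 e8
    refine ⟨e5, hr, ?_, ?_, ?_, ?_, ?_, ?_⟩ <;> linarith
  · rintro ⟨h1, h2, h3, h4, h5, h6, h7, h8⟩
    refine ⟨?_, ?_, ?_, ?_, ?_, ?_, ?_⟩
    · intro i
      fin_cases i <;> simp [circL, circS, Matrix.vec3_dotProduct, h1, h5]
    · intro i h
      fin_cases i
      · simp [circL, ha] at h
      · have e : u.l = 0 := by simpa [circL] using h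
        rw [e] at h6
        simp at h6
        nlinarith [sq_nonneg (u.s 0), sq_nonneg (u.s 1), sq_nonneg (u.s 2)]
      · simp [circL, hb] at h
    · intro i
      rw [len_lt_len_iff]
      fin_cases i <;> simp [circL, circS]
      · positivity
      · simpa [h1] using h6
      · positivity
    · intro i
      fin_cases i <;> simp [circL, circR, Matrix.vec3_dotProduct, h1, h2, h3]
    · intro i
      fin_cases i <;> simp [circL, circR, Matrix.vecHead, Matrix.vecTail, h1, h2]
    · intro i
      rw [len_sq]
      fin_cases i <;> simp [circR, h2, h4]
    · intro i
      fin_cases i <;>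
        simp [circL, circS, circR, invRadius, cross_apply, Matrix.vec3_dotProduct, Matrix.vecHead,
          Matrix.vecTail, h1, h2] <;>
        linarith

lemma Δ₀_sq (a b : ℝ) {u : Unknowns} (h : u.l 0 = 0) :
    Δ₀ a b u ^ 2 = u.s 0 ^ 2 + (u.s 1 + u.l 2 - a) ^ 2 + (u.s 2 - u.l 1) ^ 2 := by
  rw [Δ₀, impulse, len_sq]
  simp [circL, circS, circR, velocity, cross_apply, Matrix.vecHead, Matrix.vecTail, h]
  ring

lemma Δ₁_sq (a b : ℝ) {u : Unknowns} (h : u.l 0 = 0) (hr : u.r 2 = 0) :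
    Δ₁ a b u ^ 2 = (u.s 0 - u.l 2 * u.r 1 + b * u.r 1) ^ 2
      + (u.s 1 + u.l 2 * u.r 0 - b * u.r 0) ^ 2 + (u.s 2 - u.l 1 * u.r 0) ^ 2 := by
  rw [Δ₁, impulse, len_sq]
  simp [circL, circS, circR, velocity, cross_apply, Matrix.vecHead, Matrix.vecTail, h, hr]
  ring

lemma Δ₀_nonneg (a b : ℝ) (u : Unknowns) : 0 ≤ Δ₀ a b u := len_nonneg _

lemma Δ₁_nonneg (a b : ℝ) (u : Unknowns) : 0 ≤ Δ₁ a b u := len_nonneg _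

lemma f₁_eq (a b : ℝ) (u : Unknowns) : f₁ a b u = Δ₀ a b u + Δ₁ a b u := by
  simp [f₁, cost, Δ₀, Δ₁, Fin.sum_univ_two]

/-! ### Gradients of the constraint equations. -/

/-- The linear combination of the gradients of `coplanarEqs` with coefficients `c`. -/
lemma sum_smul_grad_coplanarEqs (a b : ℝ) (c : Fin 5 → ℝ) (sx sy lz x y d₀ d₁ : ℝ) :
    ∑ i, c i • grad (coplanarEqs a b i) ![sx, sy, lz, x, y, d₀, d₁] =
      ![-c 2 * y * lz - 2 * c 3 * sx - 2 * c 4 * (sx - lz * y + b * y),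
        c 1 * lz + c 2 * x * lz - 2 * c 3 * (sy + lz - a) - 2 * c 4 * (sy + lz * x - b * x),
        c 1 * (2 * lz + sy) + c 2 * (2 * lz + x * sy - y * sx) - 2 * c 3 * (sy + lz - a)
          - 2 * c 4 * (x * (sy + lz * x - b * x) - y * (sx - lz * y + b * y)),
        2 * c 0 * x + c 2 * sy * lz - 2 * c 4 * (lz - b) * (sy + lz * x - b * x),
        2 * c 0 * y - c 2 * sx * lz + 2 * c 4 * (lz - b) * (sx - lz * y + b * y),
        2 * c 3 * d₀, 2 * c 4 * d₁] := by
  funext j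
  fin_cases j <;>
    simp [Fin.sum_univ_five, grad, coplanarEqs, MvPolynomial.pderiv_X] <;> ring

/-- The linear combination of the gradients of `oppositeEqs` with coefficients `c`. -/
lemma sum_smul_grad_oppositeEqs (a b : ℝ) (c : Fin 5 → ℝ) (sx sy sz ly lz d₀ d₁ : ℝ) :
    ∑ i, c i • grad (oppositeEqs a b i) ![sx, sy, sz, ly, lz, d₀, d₁] =
      ![-2 * (c 3 + c 4) * sx,
        c 0 * ly + (c 1 - c 2) * lz - 2 * c 3 * (sy + lz - a) - 2 * c 4 * (sy - lz + b),
        c 0 * lz - (c 1 - c 2) * ly - 2 * c 3 * (sz - ly) - 2 * c 4 * (sz + ly),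
        c 0 * sy + 2 * ly * (c 1 + c 2) - sz * (c 1 - c 2) + 2 * c 3 * (sz - ly)
          - 2 * c 4 * (sz + ly),
        c 0 * sz + 2 * lz * (c 1 + c 2) + sy * (c 1 - c 2) - 2 * c 3 * (sy + lz - a)
          + 2 * c 4 * (sy - lz + b),
        2 * c 3 * d₀, 2 * c 4 * d₁] := by
  funext j
  fin_cases j <;>
    simp [Fin.sum_univ_five, grad, oppositeEqs, MvPolynomial.pderiv_X] <;> ring

lemma grad_costPoly (p : Fin 7 → ℝ) : grad costPoly p = ![0, 0, 0, 0, 0, 1, 1] := by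
  funext j
  fin_cases j <;> simp [grad, costPoly, MvPolynomial.pderiv_X]

/-! ### Real inequalities behind the optimality of the Hohmann transfer. -/

/-- `D₀ + D₁` is at least the Hohmann cost, for impulses `D₀`, `D₁` with radial parts `S`, `Q`, and
inverse angular momentum `u`; here `v` is the inverse angular momentum of the Hohmann ellipse. -/
lemma hohmann_bound_of_abs_lt {a b u v S Q D₀ D₁ : ℝ} (hab : |b| < a) (hv : 0 < v)
    (hv2 : v ^ 2 * (a ^ 2 + b ^ 2) = 2) (hD₀ : 0 ≤ D₀) (hD₁ : 0 ≤ D₁)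
    (h₀ : D₀ ^ 2 = S ^ 2 + (a ^ 2 * u - a) ^ 2) (h₁ : D₁ ^ 2 = Q ^ 2 + (b ^ 2 * u - b) ^ 2)
    (h : S ^ 2 + a ^ 4 * u ^ 2 - 2 * a ^ 2 = Q ^ 2 + b ^ 4 * u ^ 2 - 2 * b ^ 2) :
    |a ^ 2 * v - a| + |b ^ 2 * v - b| ≤ D₀ + D₁ ∧
      (D₀ + D₁ = |a ^ 2 * v - a| + |b ^ 2 * v - b| → u = v ∧ S = 0 ∧ Q = 0) := by
  have ha : 0 < a := (abs_nonneg b).trans_lt hab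
  have hb2 : b ^ 2 < a ^ 2 := by rw [← sq_abs b]; gcongr
  have hav : 1 < a * v := by
    rw [← one_lt_sq_iff₀ (by positivity)]; nlinarith [mul_pos hv hv]
  have hX : 0 < a ^ 2 * v - a := by nlinarith
  have hbv : b ^ 2 * v < a := by
    have h1 : b ^ 2 * v ^ 2 ≤ 1 := by nlinarith [mul_pos hv hv]
    refine lt_of_pow_lt_pow_left₀ 2 ha.le ?_
    nlinarith [sq_nonneg b]
  have hv4 : v ^ 2 * (a ^ 4 - b ^ 4) = 2 * (a ^ 2 - b ^ 2) := by
    linear_combination (a ^ 2 - b ^ 2) * hv2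
  have g₀ : |a ^ 2 * u - a| ≤ D₀ := abs_le_of_sq_le_sq (by nlinarith [sq_nonneg S]) hD₀
  have g₁ : |b ^ 2 * u - b| ≤ D₁ := abs_le_of_sq_le_sq (by nlinarith [sq_nonneg Q]) hD₁
  rcases lt_trichotomy u v with huv | rfl | huv
  -- By energy conservation `D₀²` minus the square of the left side is `Q² + 2 (v - u)(a² + b²)(a -
  -- b² v)`. So the first impulse gains more than `b² (v - u)`, the most that the second one can
  -- save by the triangle inequality.
  · have k : a ^ 2 * v - a + b ^ 2 * (v - u) < D₀ := by
      refine lt_of_pow_lt_pow_left₀ 2 hD₀ ?_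
      have : 0 < (v - u) * ((a ^ 2 + b ^ 2) * (a - b ^ 2 * v)) :=
        mul_pos (by linarith) (mul_pos (by positivity) (by linarith))
      nlinarith [sq_nonneg Q]
    have k₁ : |b ^ 2 * v - b| ≤ |b ^ 2 * u - b| + b ^ 2 * (v - u) := by
      have := abs_add_le (b ^ 2 * u - b) (b ^ 2 * (v - u))
      rw [abs_of_nonneg (mul_nonneg (sq_nonneg b) (by linarith : 0 ≤ v - u))] at this
      rwa [show b ^ 2 * u - b + b ^ 2 * (v - u) = b ^ 2 * v - b by ring] at this
    rw [abs_of_pos hX]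
    exact ⟨by linarith, fun e => by linarith⟩
  · refine ⟨by linarith, fun e => ⟨rfl, ?_, ?_⟩⟩
    · have : D₀ = |a ^ 2 * u - a| := by linarith
      rw [this, sq_abs] at h₀
      exact pow_eq_zero_iff two_ne_zero |>.1 (by linarith)
    · have : D₁ = |b ^ 2 * u - b| := by linarith
      rw [this, sq_abs] at h₁
      exact pow_eq_zero_iff two_ne_zero |>.1 (by linarith)
  · have k₀ : a ^ 2 * v - a < D₀ := by
      have := le_abs_self (a ^ 2 * u - a)
      have : 0 < a ^ 2 * (u - v) := mul_pos (by positivity) (by linarith)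
      linarith
    -- By energy conservation `D₁² = S² + a⁴u² - 2b³u + 3b² - 2a²`. Without `S²` this is increasing
    -- in `u ≥ v`, since `b³ < a⁴ v`, and it equals `(b² v - b)²` at `u = v`.
    have k₁ : |b ^ 2 * v - b| ≤ D₁ := by
      refine abs_le_of_sq_le_sq ?_ hD₁
      have hb3 : b ^ 3 < a ^ 3 := by
        have := abs_le.1 (le_refl |b|)
        exact Odd.strictMono_pow (by decide) (by linarith)
      have : a ^ 3 < a ^ 4 * v := by nlinarith [pow_pos ha 3]
      have : a ^ 4 * v < a ^ 4 * u := by gcongr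
      have : 0 < (u - v) * (a ^ 4 * (u + v) - 2 * b ^ 3) := mul_pos (by linarith) (by linarith)
      nlinarith [sq_nonneg S]
    rw [abs_of_pos hX]
    exact ⟨by linarith, fun e => by linarith⟩

/-- Reversing all orientations preserves the cost; this reduces the signs of `a` and `v` to the
positive case. -/
lemma abs_sq_mul_neg_sub (a v : ℝ) : |(-a) ^ 2 * -v - -a| = |a ^ 2 * v - a| := by
  rw [← abs_neg]; congr 1; ring

lemma hohmann_bound_of_sq_lt {a b u v S Q D₀ D₁ : ℝ} (hab : b ^ 2 < a ^ 2)
    (hv : 0 ≤ v * (a + b))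
    (hv2 : v ^ 2 * (a ^ 2 + b ^ 2) = 2) (hD₀ : 0 ≤ D₀) (hD₁ : 0 ≤ D₁)
    (h₀ : D₀ ^ 2 = S ^ 2 + (a ^ 2 * u - a) ^ 2) (h₁ : D₁ ^ 2 = Q ^ 2 + (b ^ 2 * u - b) ^ 2)
    (h : S ^ 2 + a ^ 4 * u ^ 2 - 2 * a ^ 2 = Q ^ 2 + b ^ 4 * u ^ 2 - 2 * b ^ 2) :
    |a ^ 2 * v - a| + |b ^ 2 * v - b| ≤ D₀ + D₁ ∧
      (D₀ + D₁ = |a ^ 2 * v - a| + |b ^ 2 * v - b| → u = v ∧ S = 0 ∧ Q = 0) := by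
  have hab' := sq_lt_sq.1 hab
  have hv0 : v ≠ 0 := by rintro rfl; norm_num at hv2
  rcases le_total 0 a with ha | ha
  · rw [abs_of_nonneg ha] at hab'
    have : 0 < a + b := by linarith [neg_abs_le b]
    have : 0 < v := (nonneg_of_mul_nonneg_left hv this).lt_of_ne' hv0
    exact hohmann_bound_of_abs_lt hab' this hv2 hD₀ hD₁ h₀ h₁ h
  · rw [abs_of_nonpos ha, ← abs_neg] at hab'
    have h1 : 0 < -a + -b := by linarith [le_abs_self (-b), neg_abs_le (-b)]
    have : 0 < -v := (nonneg_of_mul_nonneg_left (by linarith : 0 ≤ -v * (-a + -b)) h1).lt_of_ne'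
      (neg_ne_zero.2 hv0)
    have key := hohmann_bound_of_abs_lt (u := -u) (S := S) (Q := Q) hab' this (by linarith) hD₀ hD₁
      (by linarith) (by linarith) (by linarith)
    simpa only [abs_sq_mul_neg_sub, neg_inj] using key

/-- The hypotheses are symmetric under exchanging the two circles, so the one with the larger `l²`
may be taken first. -/
lemma hohmann_bound {a b u v S Q D₀ D₁ : ℝ} (hab : a ^ 2 ≠ b ^ 2) (hv : 0 ≤ v * (a + b))
    (hv2 : v ^ 2 * (a ^ 2 + b ^ 2) = 2) (hD₀ : 0 ≤ D₀) (hD₁ : 0 ≤ D₁)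
    (h₀ : D₀ ^ 2 = S ^ 2 + (a ^ 2 * u - a) ^ 2) (h₁ : D₁ ^ 2 = Q ^ 2 + (b ^ 2 * u - b) ^ 2)
    (h : S ^ 2 + a ^ 4 * u ^ 2 - 2 * a ^ 2 = Q ^ 2 + b ^ 4 * u ^ 2 - 2 * b ^ 2) :
    |a ^ 2 * v - a| + |b ^ 2 * v - b| ≤ D₀ + D₁ ∧
      (D₀ + D₁ = |a ^ 2 * v - a| + |b ^ 2 * v - b| → u = v ∧ S = 0 ∧ Q = 0) := by
  rcases hab.lt_or_gt with hab | hab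
  · have key := hohmann_bound_of_sq_lt (v := v) hab (by linarith) (by linarith) hD₁ hD₀ h₁ h₀ h.symm
    rw [add_comm D₁, add_comm |b ^ 2 * v - b|] at key
    exact ⟨key.1, fun e => ⟨(key.2 e).1, (key.2 e).2.2, (key.2 e).2.1⟩⟩
  · exact hohmann_bound_of_sq_lt hab hv hv2 hD₀ hD₁ h₀ h₁ h

/-- Here `a v ≥ 1` and `|b v| ≤ 1`, so every absolute value opens with a known sign and the
comparison is linear. -/
lemma hohmann_sign_of_abs_le {a b v : ℝ} (hab : |b| ≤ a) (hv : 0 < v)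
    (hv2 : v ^ 2 * (a ^ 2 + b ^ 2) = 2) :
    |a ^ 2 * v - a| + |b ^ 2 * v - b| ≤ |a ^ 2 * -v - a| + |b ^ 2 * -v - b| ∧
      (0 < a + b →
        |a ^ 2 * v - a| + |b ^ 2 * v - b| < |a ^ 2 * -v - a| + |b ^ 2 * -v - b|) := by
  have ha : 0 ≤ a := (abs_nonneg b).trans hab
  have hb2 : b ^ 2 ≤ a ^ 2 := by rw [← sq_abs b]; gcongr
  have hav : 1 ≤ a * v := by
    rw [← one_le_sq_iff₀ (by positivity)]; nlinarith [mul_pos hv hv]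
  have hbv : |b * v| ≤ 1 := by
    rw [← sq_le_one_iff_abs_le_one]; nlinarith [mul_pos hv hv]
  rw [abs_le] at hbv hab
  have e1 : |a ^ 2 * v - a| = a ^ 2 * v - a := abs_of_nonneg (by nlinarith)
  have e2 : |a ^ 2 * -v - a| = a ^ 2 * v + a := by
    rw [abs_of_nonpos (by nlinarith [mul_nonneg (sq_nonneg a) hv.le])]; ring
  rw [e1, e2]
  rcases le_total 0 b with hb | hb
  · have e3 : |b ^ 2 * v - b| = b - b ^ 2 * v := by rw [abs_of_nonpos (by nlinarith)]; ring
    have e4 : |b ^ 2 * -v - b| = b ^ 2 * v + b := by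
      rw [abs_of_nonpos (by nlinarith [mul_nonneg (sq_nonneg b) hv.le])]; ring
    rw [e3, e4]
    have : 0 ≤ b ^ 2 * v := by positivity
    refine ⟨by linarith, fun _ => ?_⟩
    have : 0 < a := by nlinarith
    linarith
  · have e3 : |b ^ 2 * v - b| = b ^ 2 * v - b :=
      abs_of_nonneg (by nlinarith [mul_nonneg (sq_nonneg b) hv.le])
    have e4 : |b ^ 2 * -v - b| = -b - b ^ 2 * v := by rw [abs_of_nonneg (by nlinarith)]; ring
    rw [e3, e4]
    have : b ^ 2 * v ≤ -b := by nlinarith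
    exact ⟨by linarith, fun _ => by linarith⟩

/-- The candidate whose sign is that of `a + b` is at least as cheap as the other one. -/
lemma hohmann_sign {a b v : ℝ} (hv : 0 ≤ v * (a + b)) (hv2 : v ^ 2 * (a ^ 2 + b ^ 2) = 2) :
    |a ^ 2 * v - a| + |b ^ 2 * v - b| ≤ |a ^ 2 * -v - a| + |b ^ 2 * -v - b| ∧
      (0 < v * (a + b) →
        |a ^ 2 * v - a| + |b ^ 2 * v - b| < |a ^ 2 * -v - a| + |b ^ 2 * -v - b|) := by
  have pos : ∀ {a b v : ℝ}, 0 < v → 0 ≤ a + b → v ^ 2 * (a ^ 2 + b ^ 2) = 2 →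
      |a ^ 2 * v - a| + |b ^ 2 * v - b| ≤ |a ^ 2 * -v - a| + |b ^ 2 * -v - b| ∧
      (0 < a + b →
        |a ^ 2 * v - a| + |b ^ 2 * v - b| < |a ^ 2 * -v - a| + |b ^ 2 * -v - b|) := by
    intro a b v hv h hv2
    rcases le_total b a with hab | hab
    · exact hohmann_sign_of_abs_le (abs_le.2 ⟨by linarith, hab⟩) hv hv2
    · have := hohmann_sign_of_abs_le (a := b) (b := a) (abs_le.2 ⟨by linarith, hab⟩) hv
        (by linarith)
      rwa [add_comm |b ^ 2 * v - b|, add_comm |b ^ 2 * -v - b|, add_comm b] at this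
  have hv0 : v ≠ 0 := by rintro rfl; norm_num at hv2
  rcases hv0.lt_or_gt with h | h
  · have k := pos (a := -a) (b := -b) (v := -v) (by linarith) (by nlinarith) (by linarith)
    simp only [abs_sq_mul_neg_sub] at k
    exact ⟨k.1, fun e => k.2 (by nlinarith)⟩
  · have k := pos h (nonneg_of_mul_nonneg_right hv h) hv2
    exact ⟨k.1, fun e => k.2 (pos_of_mul_pos_right e h.le)⟩

/-- Strict concavity of the square root, for the weights `(1 + z) / 2` and `(1 - z) / 2`. -/
lemma lt_of_sq_ge_convex_combination {p q z D : ℝ} (hz : |z| < 1) (hpq : p ≠ q)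
    (hD : 0 ≤ D) (h : (1 + z) / 2 * p ^ 2 + (1 - z) / 2 * q ^ 2 ≤ D ^ 2) :
    (1 + z) / 2 * p + (1 - z) / 2 * q < D := by
  rw [abs_lt] at hz
  refine lt_of_pow_lt_pow_left₀ 2 hD (lt_of_lt_of_le ?_ h)
  have : 0 < (1 + z) * (1 - z) * (p - q) ^ 2 :=
    mul_pos (mul_pos (by linarith) (by linarith)) (sq_pos_of_ne_zero (sub_ne_zero.2 hpq))
  nlinarith

/-- A convex combination of the two Hohmann costs is exceeded by the cost of a non-coplanar transfer
with impulses at opposite sides of the centre; `z` is the cosine of the inclination. -/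
lemma hohmann_lt_opposite {a b v z D₀ D₁ : ℝ} (ha : a ≠ 0) (hb : b ≠ 0) (hv : 0 ≤ v * (a + b))
    (hv2 : v ^ 2 * (a ^ 2 + b ^ 2) = 2) (hz : |z| < 1) (hD₀ : 0 ≤ D₀) (hD₁ : 0 ≤ D₁)
    (h₀ : a ^ 4 * v ^ 2 - 2 * a ^ 3 * v * z + a ^ 2 ≤ D₀ ^ 2)
    (h₁ : b ^ 4 * v ^ 2 - 2 * b ^ 3 * v * z + b ^ 2 ≤ D₁ ^ 2) :
    |a ^ 2 * v - a| + |b ^ 2 * v - b| < D₀ + D₁ := by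
  have hv0 : v ≠ 0 := by rintro rfl; norm_num at hv2
  -- The two candidates' impulses differ, which makes the concavity inequality strict.
  have ne : ∀ {a : ℝ}, a ≠ 0 → |a ^ 2 * v - a| ≠ |a ^ 2 * -v - a| := by
    intro a ha h
    rcases abs_eq_abs.1 h with h | h
    · have : a ^ 2 * v = 0 := by linarith
      simp_all
    · exact ha (by linarith)
  have k₀ := lt_of_sq_ge_convex_combination hz (ne ha) hD₀ (by simp only [sq_abs]; linarith)
  have k₁ := lt_of_sq_ge_convex_combination hz (ne hb) hD₁ (by simp only [sq_abs]; linarith)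
  -- The sum of `k₀` and `k₁` bounds `D₀ + D₁` below by a convex combination of the two candidate
  -- costs, the smaller of which is the one for `v`.
  have := (hohmann_sign hv hv2).1
  rw [abs_lt] at hz
  nlinarith

/-! ### Coplanar transfers and their Lagrange equations. -/

section Coplanar

variable {a b : ℝ} {u : Unknowns}

/-- A coplanar transfer in terms of `1 / l₁z` and of the radial velocities at the two impulses. -/
lemma coplanar_impulses (ha : a ≠ 0) (hb : b ≠ 0) (hu : IsCircTransfer a b u) (hl : u.l 1 = 0) :
    u.l 2 ≠ 0 ∧ u.s 2 = 0 ∧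
    u.s 1 = a ^ 2 / u.l 2 - u.l 2 ∧ u.s 1 * u.r 0 - u.s 0 * u.r 1 = b ^ 2 / u.l 2 - u.l 2 ∧
    Δ₀ a b u ^ 2 = u.s 0 ^ 2 + (a ^ 2 * (u.l 2)⁻¹ - a) ^ 2 ∧
    Δ₁ a b u ^ 2 = (u.s 0 * u.r 0 + u.s 1 * u.r 1) ^ 2 + (b ^ 2 * (u.l 2)⁻¹ - b) ^ 2 ∧
    u.s 0 ^ 2 + a ^ 4 * (u.l 2)⁻¹ ^ 2 - 2 * a ^ 2 =
      (u.s 0 * u.r 0 + u.s 1 * u.r 1) ^ 2 + b ^ 4 * (u.l 2)⁻¹ ^ 2 - 2 * b ^ 2 := by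
  obtain ⟨h1, h2, -, h4, h5, h6, h7, h8⟩ := (isCircTransfer_iff ha hb u).1 hu
  have e₀ := Δ₀_sq a b h1
  have e₁ := Δ₁_sq a b h1 h2
  simp only [hl] at *
  have hz : u.l 2 ≠ 0 := by
    intro h
    rw [h] at h7
    simp [ha] at h7
  have hs : u.s 2 = 0 := by simpa [hz] using h5
  simp only [hs] at *
  have hsy : u.s 1 = a ^ 2 / u.l 2 - u.l 2 := by field_simp; linarith
  have hP : u.s 1 * u.r 0 - u.s 0 * u.r 1 = b ^ 2 / u.l 2 - u.l 2 := by field_simp; linarith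
  -- `|s₁|²` is computed in the radial and tangential frame at `r̂₁`; after substitution this is
  -- conservation of energy.
  have hPQ : u.s 0 ^ 2 + u.s 1 ^ 2 = (u.s 0 * u.r 0 + u.s 1 * u.r 1) ^ 2
      + (u.s 1 * u.r 0 - u.s 0 * u.r 1) ^ 2 := by
    linear_combination -(u.s 0 ^ 2 + u.s 1 ^ 2) * h4
  refine ⟨hz, trivial, hsy, hP, ?_, ?_, ?_⟩
  · rw [e₀, hsy]; ring
  · have : Δ₁ a b u ^ 2 = (u.s 0 * u.r 0 + u.s 1 * u.r 1) ^ 2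
        + (u.s 1 * u.r 0 - u.s 0 * u.r 1 + u.l 2 - b) ^ 2 := by
      rw [e₁]
      linear_combination (-(u.s 0 ^ 2 + u.s 1 ^ 2) + (u.l 2 - b) ^ 2) * h4
    rw [this, hP]; ring
  · rw [hP, hsy] at hPQ
    rw [hsy]
    field_simp at hPQ ⊢
    linear_combination hPQ

/-- If the first impulse vanished, the spacecraft would stay on the first circle, which never meets
one of another radius. The statement is used with the circles exchanged as well. -/
lemma ne_zero_of_coplanar_left (hab : a ^ 2 ≠ b ^ 2) {w S Q D : ℝ} (ha : a ≠ 0) (hD : 0 ≤ D)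
    (h₀ : D ^ 2 = S ^ 2 + (a ^ 2 * w - a) ^ 2)
    (h : S ^ 2 + a ^ 4 * w ^ 2 - 2 * a ^ 2 = Q ^ 2 + b ^ 4 * w ^ 2 - 2 * b ^ 2) : 0 < D := by
  refine hD.lt_of_ne' ?_
  rintro rfl
  have hS : S ^ 2 = 0 := by nlinarith [sq_nonneg S, sq_nonneg (a ^ 2 * w - a)]
  have hw : a ^ 2 * w - a = 0 := by
    rw [← pow_eq_zero_iff two_ne_zero]; nlinarith [sq_nonneg S, sq_nonneg (a ^ 2 * w - a)]
  have hw1 : a * w = 1 := by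
    have : a * (a * w - 1) = 0 := by linarith
    linarith [(mul_eq_zero.1 this).resolve_left ha]
  have : a ^ 2 * Q ^ 2 + (a ^ 2 - b ^ 2) ^ 2 = 0 := by
    have e : a ^ 4 * w ^ 2 = a ^ 2 := by linear_combination a ^ 2 * (a * w + 1) * hw1
    have e' : a ^ 2 * (b ^ 4 * w ^ 2) = b ^ 4 := by linear_combination b ^ 4 * (a * w + 1) * hw1
    rw [hS] at h
    linear_combination -a ^ 2 * h + a ^ 2 * e - e'
  have : (a ^ 2 - b ^ 2) ^ 2 = 0 := by nlinarith [sq_nonneg (a * Q), sq_nonneg (a ^ 2 - b ^ 2)]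
  exact hab (sub_eq_zero.1 (pow_eq_zero_iff two_ne_zero |>.1 this))

/-- A transfer orbit tangent to the first circle, but not to the second one, is not critical. -/
lemma sq_eq_sq_of_tangent {a b w D e : ℝ} (ha : a ≠ 0)
    (hD : D ^ 2 = a ^ 4 * w ^ 2 - 2 * b ^ 3 * w + 3 * b ^ 2 - 2 * a ^ 2) (he : e ^ 2 = 1)
    (h : e * a ^ 2 * D + (a ^ 4 * w - b ^ 3) = 0) : a ^ 2 = b ^ 2 := by
  have h1 : a ^ 4 * D ^ 2 = (a ^ 4 * w - b ^ 3) ^ 2 := by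
    linear_combination (e * a ^ 2 * D - (a ^ 4 * w - b ^ 3)) * h - a ^ 4 * D ^ 2 * he
  -- The unknown `w` cancels: the difference of the two sides of `h1` is a polynomial in `a` and `b`
  -- alone.
  have h2 : (a ^ 2 - b ^ 2) ^ 2 * (2 * a ^ 2 + b ^ 2) = 0 := by
    rw [hD] at h1
    linear_combination -h1
  have h3 : 2 * a ^ 2 + b ^ 2 ≠ 0 := by positivity
  exact sub_eq_zero.1 (pow_eq_zero_iff two_ne_zero |>.1 ((mul_eq_zero.1 h2).resolve_right h3))

/-- The variety has no singular points here, so only the multiplier equation matters. Nonzero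
impulses kill the last two coefficients. A nonzero `c 2` would force `y = 0` and then `x = 1`, where
the two radii agree. -/
lemma coplanar_linearIndependent (hab : a ^ 2 ≠ b ^ 2) {sx sy lz x y d₀ d₁ : ℝ} (hz : lz ≠ 0)
    (hd₀ : d₀ ≠ 0) (hd₁ : d₁ ≠ 0) (h : x ^ 2 + y ^ 2 = 1) (hA : a ^ 2 = lz ^ 2 + sy * lz)
    (hB : b ^ 2 = lz ^ 2 + x * sy * lz - y * sx * lz) :
    LinearIndependent ℝ
      (fun i => grad (coplanarEqs a b i) ![sx, sy, lz, x, y, d₀, d₁]) := by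
  rw [Fintype.linearIndependent_iff]
  intro c hc
  rw [sum_smul_grad_coplanarEqs] at hc
  have e0 := congrFun hc 0
  have e1 := congrFun hc 1
  have e2 := congrFun hc 2
  have e3 := congrFun hc 3
  have e4 := congrFun hc 4
  have e5 := congrFun hc 5
  have e6 := congrFun hc 6
  simp [hd₀, hd₁] at e0 e1 e2 e3 e4 e5 e6
  simp only [e5, e6] at e0 e1 e2 e3 e4
  have c1 : c 1 = -c 2 * x := mul_right_cancel₀ hz (by linarith)
  have c2 : c 2 = 0 := by
    by_contra hc2
    have hy : y = 0 := by simpa [hc2, hz] using e0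
    subst hy
    have hx : x ≠ 0 := by rintro rfl; norm_num at h
    have hsx : sx = 0 := by simpa [hc2, hz] using e4
    have : c 2 * (2 * lz * (1 - x)) = 0 := by rw [c1] at e2; linarith
    have hx1 : x = 1 := by
      have := (mul_eq_zero.1 this).resolve_left hc2
      have := (mul_eq_zero.1 this).resolve_left (mul_ne_zero two_ne_zero hz)
      linarith
    subst hx1
    exact hab (by linarith)
  have c0 : c 0 = 0 := by
    rw [c2] at e3 e4
    linear_combination x / 2 * e3 + y / 2 * e4 - c 0 * h
  rw [c2] at c1
  intro i
  fin_cases i <;> simp [c0, c1, c2, e5, e6]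

/-- The Lagrange equations have no solution but `x₁ = -1`, `s₁x = 0`. -/
lemma coplanar_lagrange (ha : a ≠ 0) (hb : b ≠ 0) (hab : a ^ 2 ≠ b ^ 2)
    {c : Fin 5 → ℝ} {sx sy lz x y d₀ d₁ P Q : ℝ} (hz : lz ≠ 0)
    (hd₀ : 0 < d₀) (hd₁ : 0 < d₁) (h : x ^ 2 + y ^ 2 = 1) (hA : a ^ 2 = lz ^ 2 + sy * lz)
    (hB : b ^ 2 = lz ^ 2 + P * lz) (hP : P = x * sy - y * sx) (hQ : Q = x * sx + y * sy)
    (h₀ : d₀ ^ 2 = sx ^ 2 + (a ^ 2 * lz⁻¹ - a) ^ 2) (h₁ : d₁ ^ 2 = Q ^ 2 + (b ^ 2 * lz⁻¹ - b) ^ 2)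
    (hc : ![0, 0, 0, 0, 0, 1, 1] =
      ∑ i, c i • grad (coplanarEqs a b i) ![sx, sy, lz, x, y, d₀, d₁]) :
    x = -1 ∧ y = 0 ∧ sx = 0 := by
  rw [sum_smul_grad_coplanarEqs] at hc
  have e0 := congrFun hc 0
  have e1 := congrFun hc 1
  have e2 := congrFun hc 2
  have e3 := congrFun hc 3
  have e4 := congrFun hc 4
  have e5 := congrFun hc 5
  have e6 := congrFun hc 6
  simp only [Matrix.cons_val] at e0 e1 e2 e3 e4 e5 e6
  clear hc
  obtain ⟨p, hp⟩ : ∃ p, p = 2 * c 3 := ⟨_, rfl⟩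
  obtain ⟨q, hq⟩ : ∃ q, q = 2 * c 4 := ⟨_, rfl⟩
  rw [← hp] at e0 e1 e2 e5
  rw [← hq] at e0 e1 e2 e3 e4 e6
  generalize c 0 = c₀ at *
  generalize c 1 = c₁ at *
  generalize c 2 = c₂ at *
  have hp0 : 0 < p := pos_of_mul_pos_left (e5 ▸ one_pos) hd₀.le
  have hq0 : 0 < q := pos_of_mul_pos_left (e6 ▸ one_pos) hd₁.le
  obtain ⟨w, hw⟩ : ∃ w, w = lz⁻¹ := ⟨_, rfl⟩
  have hw1 : w * lz = 1 := by rw [hw, inv_mul_cancel₀ hz]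
  rw [← hw] at h₀ h₁
  have hsy : sy = a ^ 2 * w - lz := by linear_combination -sy * hw1 - w * hA - lz * hw1
  have hPw : P = b ^ 2 * w - lz := by linear_combination -P * hw1 - w * hB - lz * hw1
  have hsum : sx ^ 2 + sy ^ 2 = P ^ 2 + Q ^ 2 := by
    rw [hP, hQ]; linear_combination -(sx ^ 2 + sy ^ 2) * h
  have e2' : 0 = c₁ * (2 * lz + sy) + c₂ * (2 * lz + P) - p * (sy + lz - a) - q * (P + lz - b) := by
    linear_combination e2 - (c₂ - q) * hP - q * (lz - b) * h
  -- Stationarity under rotation of `r̂₁`: the combination eliminates the multiplier of `x² + y² =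
  -- 1`. The first factor leads to tangency at the first circle, the second (`Q = 0`) is tangency at
  -- the second.
  have key : (c₂ * lz - q * (lz - b)) * Q = 0 := by
    rw [hQ]; linear_combination x * e4 - y * e3
  rcases mul_eq_zero.1 key with k | k
  · have hsx : sx = 0 := by
      have : (p + q) * sx = 0 := by linear_combination e0 - y * k
      exact (mul_eq_zero.1 this).resolve_left (by positivity)
    subst hsx
    exfalso
    have k₁ : c₁ * lz = p * (sy + lz - a) + q * sy := by
      linear_combination -e1 - x * k
    rw [hsy, hPw] at hsum e2'
    rw [hsy] at k₁
    have T : p * (a ^ 2 * w - a) * a ^ 2 * w + q * (a ^ 4 * w ^ 2 - b ^ 3 * w) = 0 := by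
      linear_combination -lz * e2' - (lz + a ^ 2 * w) * k₁ - (lz + b ^ 2 * w) * k
    -- Since `sx = 0`, `d₀ = |a² w - a|`; as `p = 1 / d₀`, the number `p (a² w - a)` is a sign.
    refine hab (sq_eq_sq_of_tangent (w := w) (D := d₁) (e := p * (a ^ 2 * w - a)) ha ?_ ?_ ?_)
    · linear_combination h₁ - hsum - 2 * (a ^ 2 - b ^ 2) * hw1
    · linear_combination -p ^ 2 * h₀ - (p * d₀ + 1) * e5
    · linear_combination d₁ * lz * T + (a ^ 4 * w - b ^ 3) * e6 -
        (p * (a ^ 2 * w - a) * a ^ 2 * d₁ + q * d₁ * (a ^ 4 * w - b ^ 3)) * hw1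
  · have hsx : sx = -P * y := by rw [hP]; linear_combination x * k - x * hQ - sx * h
    have hsy' : sy = P * x := by rw [hP]; linear_combination y * k - y * hQ - sy * h
    by_cases hy : y = 0
    · subst hy
      have hx : x ^ 2 = 1 ^ 2 := by linear_combination h
      rcases sq_eq_sq_iff_eq_or_eq_neg.1 hx with rfl | rfl
      · exact absurd (by rw [hA, hB, hP]; ring) hab
      · exact ⟨rfl, rfl, by rw [hsx]; ring⟩
    · exfalso
      have k₂ : c₂ * lz = p * P + q * (P + lz - b) := by
        refine mul_left_cancel₀ hy ?_
        rw [hsx] at e0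
        linear_combination e0
      have k₁ : c₁ * lz = p * (lz - a) := by
        rw [hsy'] at e1
        linear_combination -e1 - x * k₂
      rw [hsy, hPw] at e2'
      rw [hPw] at k₂
      have T : q * (b ^ 2 * w - b) * b ^ 2 * w + p * (b ^ 4 * w ^ 2 - a ^ 3 * w) = 0 := by
        linear_combination -lz * e2' - (lz + a ^ 2 * w) * k₁ - (lz + b ^ 2 * w) * k₂
      rw [hsy, hPw, k] at hsum
      refine hab (sq_eq_sq_of_tangent (w := w) (D := d₀) (e := q * (b ^ 2 * w - b)) hb ?_ ?_ ?_).symm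
      · linear_combination h₀ + hsum + 2 * (a ^ 2 - b ^ 2) * hw1
      · rw [k] at h₁
        linear_combination -q ^ 2 * h₁ - (q * d₁ + 1) * e6
      · linear_combination d₀ * lz * T + (b ^ 4 * w - a ^ 3) * e5 -
          (q * (b ^ 2 * w - b) * b ^ 2 * d₀ + p * d₀ * (b ^ 4 * w - a ^ 3)) * hw1

end Coplanar

/-! ### The two Hohmann candidates and the coplanar critical points. -/

variable {a b ε : ℝ} {u : Unknowns}

/-- The inverse angular momentum of the Hohmann ellipse. -/
noncomputable def hohmannInv (a b ε : ℝ) : ℝ := ε / √((a ^ 2 + b ^ 2) / 2)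

lemma sq_eq_one_of_sign (hε : ε = 1 ∨ ε = -1) : ε ^ 2 = 1 := by
  rcases hε with rfl | rfl <;> norm_num

lemma sqrt_half_pos (ha : a ≠ 0) : 0 < √((a ^ 2 + b ^ 2) / 2) :=
  Real.sqrt_pos.2 (by positivity)

lemma sqrt_half_sq (a b : ℝ) : √((a ^ 2 + b ^ 2) / 2) ^ 2 = (a ^ 2 + b ^ 2) / 2 :=
  Real.sq_sqrt (by positivity)

lemma hohmannInv_sq (ha : a ≠ 0) (hε : ε = 1 ∨ ε = -1) :
    hohmannInv a b ε ^ 2 * (a ^ 2 + b ^ 2) = 2 := by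
  have : a ^ 2 + b ^ 2 ≠ 0 := by positivity
  rw [hohmannInv, div_pow, sqrt_half_sq, sq_eq_one_of_sign hε]
  field_simp

lemma hohmannInv_mul_nonneg (h : 0 ≤ ε * (a + b)) : 0 ≤ hohmannInv a b ε * (a + b) := by
  rw [hohmannInv, div_mul_eq_mul_div]
  positivity

lemma hohmannInv_mul_pos (ha : a ≠ 0) (h : 0 < ε * (a + b)) :
    0 < hohmannInv a b ε * (a + b) := by
  rw [hohmannInv, div_mul_eq_mul_div]
  exact div_pos h (sqrt_half_pos ha)

lemma hohmannInv_neg (a b ε : ℝ) : hohmannInv a b (-ε) = -hohmannInv a b ε := by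
  rw [hohmannInv, hohmannInv, neg_div]

lemma hohmannCost_eq (a b ε : ℝ) :
    hohmannCost a b ε = |a ^ 2 * hohmannInv a b ε - a| + |b ^ 2 * hohmannInv a b ε - b| := by
  have h (c : ℝ) : ε * √2 * c / √(a ^ 2 + b ^ 2) = c * hohmannInv a b ε := by
    rw [hohmannInv, Real.sqrt_div (by positivity), div_div_eq_mul_div]
    ring
  rw [hohmannCost, h, h]

lemma hohmann_l_inv (hε : ε = 1 ∨ ε = -1) : ((hohmann a b ε).l 2)⁻¹ = hohmannInv a b ε := by
  rcases hε with rfl | rfl <;> simp [hohmann, hohmannInv, neg_div]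

lemma isCircTransfer_hohmann (ha : a ≠ 0) (hb : b ≠ 0) (hε : ε = 1 ∨ ε = -1) :
    IsCircTransfer a b (hohmann a b ε) := by
  have hs := sqrt_half_sq a b
  have hp : 0 < √((a ^ 2 + b ^ 2) / 2) := sqrt_half_pos ha
  have he := sq_eq_one_of_sign hε
  rw [isCircTransfer_iff ha hb]
  simp only [hohmann, Matrix.cons_val]
  generalize √((a ^ 2 + b ^ 2) / 2) = L at *
  have hab : a ^ 2 + b ^ 2 ≠ 0 := by positivity
  have hl : (ε * L) ^ 2 = (a ^ 2 + b ^ 2) / 2 := by rw [mul_pow, he, hs, one_mul]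
  refine ⟨trivial, trivial, by ring, by ring, by ring, ?_, ?_, ?_⟩
  · have : ((a ^ 2 - b ^ 2) / (a ^ 2 + b ^ 2)) ^ 2 < 1 := by
      rw [div_pow, div_lt_one (by positivity)]
      nlinarith [mul_pos (pow_pos (abs_pos.2 ha) 2) (pow_pos (abs_pos.2 hb) 2), sq_abs a, sq_abs b]
    rw [mul_pow, hl]
    nlinarith [sq_abs a, sq_abs b, pow_pos (abs_pos.2 ha) 2]
  · generalize ε * L = l at *
    field_simp
    linear_combination -2 * a ^ 2 * hl
  · generalize ε * L = l at *
    field_simp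
    linear_combination -2 * b ^ 2 * hl

lemma hohmann_impulses (ha : a ≠ 0) (hb : b ≠ 0) (hε : ε = 1 ∨ ε = -1) :
    Δ₀ a b (hohmann a b ε) = |a ^ 2 * hohmannInv a b ε - a| ∧
      Δ₁ a b (hohmann a b ε) = |b ^ 2 * hohmannInv a b ε - b| := by
  obtain ⟨-, -, -, -, h₀, h₁, -⟩ :=
    coplanar_impulses ha hb (isCircTransfer_hohmann ha hb hε) (by simp [hohmann])
  rw [hohmann_l_inv hε] at h₀ h₁
  constructor
  · rw [← abs_of_nonneg (Δ₀_nonneg a b _), ← sq_eq_sq_iff_abs_eq_abs, h₀]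
    simp [hohmann]
  · rw [← abs_of_nonneg (Δ₁_nonneg a b _), ← sq_eq_sq_iff_abs_eq_abs, h₁]
    simp [hohmann]

lemma f₁_hohmann (ha : a ≠ 0) (hb : b ≠ 0) (hε : ε = 1 ∨ ε = -1) :
    f₁ a b (hohmann a b ε) = hohmannCost a b ε := by
  rw [f₁_eq, (hohmann_impulses ha hb hε).1, (hohmann_impulses ha hb hε).2, hohmannCost_eq]

/-- A coplanar transfer whose second impulse is opposite to the first one, with an intermediate orbit
tangent to the first circle, has the intermediate orbit of `hohmann`. -/
lemma eq_hohmann (ha : a ≠ 0) (hb : b ≠ 0) (hu : IsCircTransfer a b u) (hl : u.l 1 = 0)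
    (hz : u.l 2 = ε * √((a ^ 2 + b ^ 2) / 2)) (hx : u.r 0 = -1) (hy : u.r 1 = 0)
    (hs : u.s 0 = 0) : u = hohmann a b ε := by
  obtain ⟨h1, h2, -, -, -, -, h7, h8⟩ := (isCircTransfer_iff ha hb u).1 hu
  obtain ⟨-, hs2, -⟩ := coplanar_impulses ha hb hu hl
  have hab : a ^ 2 + b ^ 2 ≠ 0 := by positivity
  rw [hl, hs2] at h7 h8
  rw [hx, hy] at h8
  have hs1 : u.s 1 = (a ^ 2 - b ^ 2) / (a ^ 2 + b ^ 2) * u.l 2 := by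
    field_simp
    linear_combination (u.s 1 - u.l 2) * h7 + (u.s 1 + u.l 2) * h8
  ext i
  · fin_cases i
    · exact h1
    · exact hl
    · exact hz
  · fin_cases i
    · exact hs
    · rw [hz] at hs1
      exact hs1
    · exact hs2
  · fin_cases i
    · exact hx
    · exact hy
    · exact h2

lemma eval_coplanarEqs (a b : ℝ) (h1 : u.l 0 = 0) (h2 : u.r 2 = 0) (hl : u.l 1 = 0)
    (hs : u.s 2 = 0) (h4 : u.r 0 ^ 2 + u.r 1 ^ 2 = 1)
    (h7 : a ^ 2 = u.l 1 ^ 2 + u.l 2 ^ 2 + u.s 1 * u.l 2 - u.s 2 * u.l 1)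
    (h8 : b ^ 2 = u.l 1 ^ 2 + u.l 2 ^ 2 + (u.s 1 * u.l 2 - u.s 2 * u.l 1) * u.r 0
        - u.s 0 * u.l 2 * u.r 1) (i : Fin 5) :
    MvPolynomial.eval (coplanarPoint a b u) (coplanarEqs a b i) = 0 := by
  have e₀ := Δ₀_sq a b h1
  have e₁ := Δ₁_sq a b h1 h2
  rw [hl, hs] at *
  fin_cases i <;> simp [coplanarEqs, coplanarPoint] <;> linarith

lemma isCoplanarCritical_iff (ha : a ≠ 0) (hb : b ≠ 0) (hab : a ^ 2 ≠ b ^ 2) (u : Unknowns) :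
    IsCoplanarCritical a b u ↔ u = hohmann a b 1 ∨ u = hohmann a b (-1) := by
  have pos : ∀ u, IsCircTransfer a b u → u.l 1 = 0 → 0 < Δ₀ a b u ∧ 0 < Δ₁ a b u := by
    intro u hu hl
    obtain ⟨-, -, -, -, h₀, h₁, h⟩ := coplanar_impulses ha hb hu hl
    exact ⟨ne_zero_of_coplanar_left hab ha (Δ₀_nonneg a b u) h₀ h,
      ne_zero_of_coplanar_left hab.symm hb (Δ₁_nonneg a b u) h₁ h.symm⟩
  constructor
  · rintro ⟨hu, hl, -, hcrit⟩
    obtain ⟨h1, h2, -, h4, -, -, h7, h8⟩ := (isCircTransfer_iff ha hb u).1 hu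
    obtain ⟨hz, hs, hsy, hP, h₀, h₁, h⟩ := coplanar_impulses ha hb hu hl
    obtain ⟨p₀, p₁⟩ := pos u hu hl
    rw [hl, hs] at h7 h8
    have hA : a ^ 2 = u.l 2 ^ 2 + u.s 1 * u.l 2 := by linarith
    have hB : b ^ 2 = u.l 2 ^ 2 + (u.r 0 * u.s 1 - u.r 1 * u.s 0) * u.l 2 := by linarith
    have key : u.r 0 = -1 ∧ u.r 1 = 0 ∧ u.s 0 = 0 := by
      rcases hcrit with hc | ⟨c, hc⟩
      · exact absurd (coplanar_linearIndependent hab hz p₀.ne' p₁.ne' h4 hA (by linarith)) hc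
      · rw [grad_costPoly] at hc
        exact coplanar_lagrange ha hb hab hz p₀ p₁ h4 hA hB rfl rfl h₀
          (by rw [h₁]; ring) hc
    obtain ⟨hx, hy, hs0⟩ := key
    have hl2 : u.l 2 ^ 2 = √((a ^ 2 + b ^ 2) / 2) ^ 2 := by
      rw [sqrt_half_sq]; rw [hx, hy] at hB; linarith
    rcases sq_eq_sq_iff_eq_or_eq_neg.1 hl2 with hl2 | hl2
    · exact .inl (eq_hohmann ha hb hu hl (by linarith) hx hy hs0)
    · exact .inr (eq_hohmann ha hb hu hl (by linarith) hx hy hs0)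
  · intro h
    obtain ⟨ε, hε, rfl⟩ : ∃ ε : ℝ, (ε = 1 ∨ ε = -1) ∧ u = hohmann a b ε := by
      rcases h with rfl | rfl
      · exact ⟨1, .inl rfl, rfl⟩
      · exact ⟨-1, .inr rfl, rfl⟩
    have hu := isCircTransfer_hohmann ha hb hε
    have hl : (hohmann a b ε).l 1 = 0 := rfl
    obtain ⟨h1, h2, -, h4, -, -, h7, h8⟩ := (isCircTransfer_iff ha hb _).1 hu
    obtain ⟨hz, hs, -⟩ := coplanar_impulses ha hb hu hl
    obtain ⟨p₀, p₁⟩ := pos _ hu hl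
    refine ⟨hu, hl, eval_coplanarEqs a b h1 h2 hl hs h4 h7 h8, .inr ?_⟩
    have hpt : coplanarPoint a b (hohmann a b ε) = ![0, (hohmann a b ε).s 1, (hohmann a b ε).l 2,
      -1, 0, Δ₀ a b (hohmann a b ε), Δ₁ a b (hohmann a b ε)] := rfl
    rw [hpt, grad_costPoly]
    generalize (hohmann a b ε).s 1 = sy at *
    generalize (hohmann a b ε).l 2 = l at *
    generalize Δ₀ a b (hohmann a b ε) = d₀ at *
    generalize Δ₁ a b (hohmann a b ε) = d₁ at *
    -- The last two equations give `c 3` and `c 4`. The equation for `s₁y` gives `c 1 - c 2 = (t₀ +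
    -- t₁) / l`, the one for `l₁z` then gives `c 2`, and the one for `x₁` gives `c 0`.
    let t₀ := d₀⁻¹ * (sy + l - a)
    let t₁ := d₁⁻¹ * (sy - l + b)
    let c₂ := (t₀ - t₁ - (2 * l + sy) * (t₀ + t₁) / l) / (4 * l)
    refine ⟨![(c₂ * sy * l - t₁ * (l - b)) / 2, c₂ + (t₀ + t₁) / l, c₂, d₀⁻¹ / 2, d₁⁻¹ / 2], ?_⟩
    rw [sum_smul_grad_coplanarEqs]
    have hd₀ := p₀.ne'
    have hd₁ := p₁.ne'
    funext j
    fin_cases j <;> simp [t₀, t₁, c₂] <;> field_simp <;> ring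

lemma hohmannCost_self (ha : a ≠ 0) (hε : ε = 1 ∨ ε = -1) (h : 0 ≤ ε * (a + a)) :
    hohmannCost a a ε = 0 := by
  have h1 := hohmannInv_sq (b := a) ha hε
  have h2 := hohmannInv_mul_nonneg h
  rw [hohmannCost_eq]
  generalize hohmannInv a a ε = v at *
  have : a * v = 1 := by
    have : (a * v) ^ 2 = 1 ^ 2 := by linear_combination h1 / 2
    rcases sq_eq_sq_iff_eq_or_eq_neg.1 this with h | h
    · exact h
    · linarith
  have : a ^ 2 * v - a = 0 := by linear_combination a * this
  simp [this]

/-- Here `a v = ±1`: one impulse vanishes and the other reverses the velocity. -/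
lemma hohmannCost_neg_self (ha : a ≠ 0) (hε : ε = 1 ∨ ε = -1) :
    hohmannCost a (-a) ε = 2 * |a| := by
  have h1 := hohmannInv_sq (b := -a) ha hε
  rw [hohmannCost_eq]
  generalize hohmannInv a (-a) ε = v at *
  have : (a * v) ^ 2 = 1 ^ 2 := by linear_combination h1 / 2
  rcases sq_eq_sq_iff_eq_or_eq_neg.1 this with h | h
  · rw [show a ^ 2 * v - a = 0 by linear_combination a * h,
      show (-a) ^ 2 * v - -a = 2 * a by linear_combination a * h, abs_mul]
    simp
  · rw [show a ^ 2 * v - a = -(2 * a) by linear_combination a * h,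
      show (-a) ^ 2 * v - -a = 0 by linear_combination a * h, abs_neg, abs_mul]
    simp

/-! ### Non-coplanar transfers and global optimality. -/

/-- The intermediate orbit of a transfer with impulses at opposite sides of the centre. -/
lemma opposite_orbit (ha : a ≠ 0) (hb : b ≠ 0) (hu : IsCircTransfer a b u)
    (hr : u.r = ![-1, 0, 0]) :
    u.l 1 ^ 2 + u.l 2 ^ 2 = (a ^ 2 + b ^ 2) / 2 ∧
    u.s 1 = (a ^ 2 - b ^ 2) / (a ^ 2 + b ^ 2) * u.l 2 ∧
    u.s 2 = -((a ^ 2 - b ^ 2) / (a ^ 2 + b ^ 2) * u.l 1) := by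
  obtain ⟨-, -, -, -, h5, -, h7, h8⟩ := (isCircTransfer_iff ha hb u).1 hu
  simp only [hr, Matrix.cons_val] at h8
  have hab : a ^ 2 + b ^ 2 ≠ 0 := by positivity
  refine ⟨by linarith, ?_, ?_⟩
  · field_simp
    linear_combination (u.s 1 - u.l 2) * h7 + (u.s 1 + u.l 2) * h8 + 2 * u.l 1 * h5
  · field_simp
    linear_combination (u.s 2 + u.l 1) * h7 + (u.s 2 - u.l 1) * h8 + 2 * u.l 2 * h5

/-- Only `s₁x` and `l₁z` remain free, and the squared impulses are affine in `l₁z`. This serves both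
the concavity estimate and the solution of the critical equation. -/
lemma opposite_impulses (ha : a ≠ 0) (hu : u.l 0 = 0) (hr : u.r = ![-1, 0, 0])
    (hl : u.l 1 ^ 2 + u.l 2 ^ 2 = (a ^ 2 + b ^ 2) / 2)
    (hs₁ : u.s 1 = (a ^ 2 - b ^ 2) / (a ^ 2 + b ^ 2) * u.l 2)
    (hs₂ : u.s 2 = -((a ^ 2 - b ^ 2) / (a ^ 2 + b ^ 2) * u.l 1)) :
    (a ^ 2 + b ^ 2) * Δ₀ a b u ^ 2 =
      (a ^ 2 + b ^ 2) * (u.s 0 ^ 2 + a ^ 2) + 2 * a ^ 4 - 4 * a ^ 3 * u.l 2 ∧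
    (a ^ 2 + b ^ 2) * Δ₁ a b u ^ 2 =
      (a ^ 2 + b ^ 2) * (u.s 0 ^ 2 + b ^ 2) + 2 * b ^ 4 - 4 * b ^ 3 * u.l 2 := by
  have e₀ := Δ₀_sq a b hu
  have e₁ := Δ₁_sq a b hu (by rw [hr]; rfl)
  simp only [hr, Matrix.cons_val, hs₁, hs₂] at e₀ e₁
  have hab : a ^ 2 + b ^ 2 ≠ 0 := by positivity
  rw [e₀, e₁]
  constructor
  · field_simp
    linear_combination 4 * a ^ 4 * hl
  · field_simp
    linear_combination 4 * b ^ 4 * hl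

lemma hohmannCost_lt_of_opposite (ha : a ≠ 0) (hb : b ≠ 0) (hε : ε = 1 ∨ ε = -1)
    (hab : 0 ≤ ε * (a + b)) (hu : IsCircTransfer a b u) (hl : u.l 1 ≠ 0)
    (hr : u.r = ![-1, 0, 0]) : hohmannCost a b ε < f₁ a b u := by
  obtain ⟨hL, hs₁, hs₂⟩ := opposite_orbit ha hb hu hr
  obtain ⟨h₀, h₁⟩ := opposite_impulses ha ((isCircTransfer_iff ha hb u).1 hu).1 hr hL hs₁ hs₂
  have hv := hohmannInv_sq (b := b) ha hε
  have hv' := hohmannInv_mul_nonneg hab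
  rw [hohmannCost_eq, f₁_eq]
  generalize hohmannInv a b ε = v at *
  have hp : 0 < a ^ 2 + b ^ 2 := by positivity
  -- As `|l₁| = 1 / |v|`, `l₁z v` is the cosine of the angle between `l₁` and `(0, 0, ε)`. It has
  -- modulus less than `1` because `l₁y ≠ 0`.
  refine hohmann_lt_opposite (z := u.l 2 * v) ha hb hv' hv ?_ (Δ₀_nonneg a b u) (Δ₁_nonneg a b u)
    ?_ ?_
  · rw [← sq_lt_one_iff_abs_lt_one]
    have : 0 < u.l 1 ^ 2 * v ^ 2 := by
      have : v ≠ 0 := by rintro rfl; norm_num at hv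
      positivity
    linear_combination this + v ^ 2 * hL + hv / 2
  · refine le_of_mul_le_mul_left ?_ hp
    rw [h₀]
    linear_combination (a ^ 4 - 2 * a ^ 3 * u.l 2) * hv + (a ^ 2 + b ^ 2) * sq_nonneg (u.s 0)
  · refine le_of_mul_le_mul_left ?_ hp
    rw [h₁]
    linear_combination (b ^ 4 - 2 * b ^ 3 * u.l 2) * hv + (a ^ 2 + b ^ 2) * sq_nonneg (u.s 0)

lemma abs_lt_of_sq_add {p k D : ℝ} (hk : 0 < k) (hD : 0 ≤ D) (h : D ^ 2 = p ^ 2 + k) : |p| < D :=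
  abs_lt_of_sq_lt_sq (by linarith) hD

lemma two_mul_abs_le (a p : ℝ) : 2 * |a| ≤ |p - a| + |p + a| := by
  have := abs_sub (p + a) (p - a)
  rw [show p + a - (p - a) = 2 * a by ring, abs_mul, abs_two] at this
  linarith

/-- Two non-coplanar impulses at the same point. -/
lemma hohmannCost_lt_of_adjacent (ha : a ≠ 0) (hb : b ≠ 0) (hε : ε = 1 ∨ ε = -1)
    (hab : 0 ≤ ε * (a + b)) (hu : IsCircTransfer a b u) (hl : u.l 1 ≠ 0)
    (hr : u.r = ![1, 0, 0]) : hohmannCost a b ε < f₁ a b u := by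
  obtain ⟨h1, h2, -, -, h5, -, h7, h8⟩ := (isCircTransfer_iff ha hb u).1 hu
  have e₀ := Δ₀_sq a b h1
  have e₁ := Δ₁_sq a b h1 h2
  simp only [hr, Matrix.cons_val] at h8 e₁
  -- The out-of-plane velocity at the common point cannot vanish, so each impulse strictly exceeds
  -- its component along the circle.
  have hk : u.s 2 - u.l 1 ≠ 0 := by
    intro h
    have h2 : u.s 2 = u.l 1 := by linarith
    have h3 : u.s 1 + u.l 2 = 0 := by
      have : u.l 1 * (u.s 1 + u.l 2) = 0 := by rw [h2] at h5; linarith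
      exact (mul_eq_zero.1 this).resolve_left hl
    have : a ^ 2 = 0 := by rw [h7, h2]; linear_combination u.l 2 * h3
    exact ha (pow_eq_zero_iff two_ne_zero |>.1 this)
  have hk2 : 0 < u.s 0 ^ 2 + (u.s 2 - u.l 1) ^ 2 := by positivity
  have g₀ : |u.s 1 + u.l 2 - a| < Δ₀ a b u :=
    abs_lt_of_sq_add hk2 (Δ₀_nonneg a b u) (by rw [e₀]; ring)
  have g₁ : |u.s 1 + u.l 2 - b| < Δ₁ a b u :=
    abs_lt_of_sq_add hk2 (Δ₁_nonneg a b u) (by rw [e₁]; ring)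
  rw [f₁_eq]
  rcases sq_eq_sq_iff_eq_or_eq_neg.1 (show b ^ 2 = a ^ 2 by linarith) with rfl | rfl
  · rw [hohmannCost_self ha hε hab]
    linarith [abs_nonneg (u.s 1 + u.l 2 - b)]
  · rw [hohmannCost_neg_self ha hε]
    rw [sub_neg_eq_add] at g₁
    linarith [two_mul_abs_le a (u.s 1 + u.l 2)]

lemma isCircTransfer_cases (ha : a ≠ 0) (hb : b ≠ 0) (hu : IsCircTransfer a b u) :
    u.l 0 = 0 ∧ u.r 2 = 0 ∧ u.l 1 * u.r 1 = 0 ∧ (u.l 1 = 0 → u.s 2 = 0) ∧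
      (u.l 1 ≠ 0 → u.r = ![1, 0, 0] ∨ u.r = ![-1, 0, 0]) ∧
      (u.l 1 ≠ 0 → u.r = ![1, 0, 0] → a ^ 2 = b ^ 2) := by
  obtain ⟨h1, h2, h3, h4, -, -, h7, h8⟩ := (isCircTransfer_iff ha hb u).1 hu
  refine ⟨h1, h2, h3, fun h => (coplanar_impulses ha hb hu h).2.1, fun h => ?_, fun h hr => ?_⟩
  · have hy : u.r 1 = 0 := (mul_eq_zero.1 h3).resolve_left h
    rw [hy] at h4
    refine (sq_eq_sq_iff_eq_or_eq_neg.1 (show u.r 0 ^ 2 = 1 ^ 2 by linarith)).imp ?_ ?_ <;>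
    · intro hx
      funext i
      fin_cases i
      · exact hx
      · exact hy
      · exact h2
  · simp only [hr, Matrix.cons_val] at h8
    linarith

lemma hohmannCost_lt_of_noncoplanar (ha : a ≠ 0) (hb : b ≠ 0) (hε : ε = 1 ∨ ε = -1)
    (hab : 0 ≤ ε * (a + b)) (hu : IsCircTransfer a b u) (hl : u.l 1 ≠ 0) :
    hohmannCost a b ε < f₁ a b u := by
  obtain ⟨-, -, -, -, hr, -⟩ := isCircTransfer_cases ha hb hu
  rcases hr hl with hr | hr
  · exact hohmannCost_lt_of_adjacent ha hb hε hab hu hl hr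
  · exact hohmannCost_lt_of_opposite ha hb hε hab hu hl hr

lemma hohmannCost_le (ha : a ≠ 0) (hb : b ≠ 0) (hε : ε = 1 ∨ ε = -1)
    (hab : 0 ≤ ε * (a + b)) (hu : IsCircTransfer a b u) : hohmannCost a b ε ≤ f₁ a b u := by
  by_cases hl : u.l 1 = 0
  · obtain ⟨-, -, -, -, h₀, h₁, h⟩ := coplanar_impulses ha hb hu hl
    have p₀ := Δ₀_nonneg a b u
    have p₁ := Δ₁_nonneg a b u
    rw [f₁_eq]
    by_cases hab2 : a ^ 2 = b ^ 2
    · rcases sq_eq_sq_iff_eq_or_eq_neg.1 hab2.symm with rfl | rfl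
      · rw [hohmannCost_self ha hε hab]
        positivity
      · rw [hohmannCost_neg_self ha hε]
        have g₀ : |a ^ 2 * (u.l 2)⁻¹ - a| ≤ Δ₀ a (-a) u :=
          abs_le_of_sq_le_sq (by rw [h₀]; exact le_add_of_nonneg_left (sq_nonneg _)) p₀
        have g₁ : |a ^ 2 * (u.l 2)⁻¹ + a| ≤ Δ₁ a (-a) u :=
          abs_le_of_sq_le_sq (by
            rw [h₁, neg_sq, sub_neg_eq_add]; exact le_add_of_nonneg_left (sq_nonneg _)) p₁
        linarith [two_mul_abs_le a (a ^ 2 * (u.l 2)⁻¹)]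
    · rw [hohmannCost_eq]
      exact (hohmann_bound hab2 (hohmannInv_mul_nonneg hab) (hohmannInv_sq ha hε) p₀ p₁ h₀ h₁ h).1
  · exact (hohmannCost_lt_of_noncoplanar ha hb hε hab hu hl).le

lemma eq_hohmann_of_f₁_eq (ha : a ≠ 0) (hb : b ≠ 0) (hε : ε = 1 ∨ ε = -1)
    (hab : 0 ≤ ε * (a + b)) (hab2 : a ^ 2 ≠ b ^ 2) (hu : IsCircTransfer a b u)
    (hf : f₁ a b u = hohmannCost a b ε) : u = hohmann a b ε := by
  have hl : u.l 1 = 0 := by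
    by_contra hl
    exact (hohmannCost_lt_of_noncoplanar ha hb hε hab hu hl).ne' hf
  obtain ⟨hz, hs2, hsy, hP, h₀, h₁, h⟩ := coplanar_impulses ha hb hu hl
  obtain ⟨-, -, -, h4, -⟩ := (isCircTransfer_iff ha hb u).1 hu
  rw [f₁_eq, hohmannCost_eq] at hf
  obtain ⟨hv, hS, hQ⟩ := (hohmann_bound hab2 (hohmannInv_mul_nonneg hab) (hohmannInv_sq ha hε)
    (Δ₀_nonneg a b u) (Δ₁_nonneg a b u) h₀ h₁ h).2 hf
  rw [← hohmann_l_inv hε] at hv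
  have hlz : u.l 2 = ε * √((a ^ 2 + b ^ 2) / 2) := inv_injective hv
  have hl2 : u.l 2 ^ 2 = (a ^ 2 + b ^ 2) / 2 := by
    rw [hlz, mul_pow, sq_eq_one_of_sign hε, sqrt_half_sq, one_mul]
  rw [hS] at hP hQ
  -- If `s₁y = 0`, the orbit would be a circle with `l₁z² = a²`, contradicting `l₁z² = (a² + b²) /
  -- 2`. With `s₁ ≠ 0` along the y-axis, `Q = 0` fixes the axis of `r̂₁`.
  have hs : u.s 1 ≠ 0 := by
    intro h
    rw [h] at hsy
    field_simp at hsy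
    exact hab2 (by linarith)
  have hy : u.r 1 = 0 := by
    have : u.s 1 * u.r 1 = 0 := by linarith
    exact (mul_eq_zero.1 this).resolve_left hs
  have hx : u.r 0 = -1 := by
    refine mul_left_cancel₀ hs ?_
    rw [hy] at hP
    rw [show u.s 1 * u.r 0 = b ^ 2 / u.l 2 - u.l 2 by linarith, hsy]
    field_simp
    linarith
  exact eq_hohmann ha hb hu hl hlz hx hy hS

/-! ### Opposite orbits on one circle. -/

/-- The transfers of minimal cost between opposite orbits on the same circle which apply both
impulses at the same point. -/
lemma adjacent_minimizer_iff (ha : a ≠ 0) (u : Unknowns) :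
    IsCircTransfer a (-a) u ∧ u.r = ![1, 0, 0] ∧ f₁ a (-a) u = 2 * |a| ↔
      ∃ τ : ℝ, τ ≠ 0 ∧ |τ| ≤ 1 ∧
        u = ⟨![0, 0, a / τ], ![0, τ * a - a / τ, 0], ![1, 0, 0]⟩ := by
  have hb := neg_ne_zero.2 ha
  constructor
  · rintro ⟨hu, hr, hf⟩
    have hl : u.l 1 = 0 := by
      by_contra hl
      have := hohmannCost_lt_of_noncoplanar ha hb (.inl rfl) (by simp) hu hl
      rw [hohmannCost_neg_self ha (.inl rfl)] at this
      exact this.ne' hf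
    obtain ⟨hz, hs2, hsy, -, h₀, h₁, -⟩ := coplanar_impulses ha hb hu hl
    have p₀ := Δ₀_nonneg a (-a) u
    have p₁ := Δ₁_nonneg a (-a) u
    rw [f₁_eq] at hf
    simp only [hr, Matrix.cons_val, neg_sq, sub_neg_eq_add, mul_one, mul_zero, add_zero] at h₁
    -- A radial velocity would make both impulses strictly longer than their tangential parts, which
    -- already sum to at least `2|a|`.
    have hs : u.s 0 = 0 := by
      by_contra hs
      have hs2 : 0 < u.s 0 ^ 2 := by positivity
      have g₀ := abs_lt_of_sq_add hs2 p₀ (h₀.trans (add_comm _ _))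
      have g₁ := abs_lt_of_sq_add hs2 p₁ (h₁.trans (add_comm _ _))
      linarith [two_mul_abs_le a (a ^ 2 * (u.l 2)⁻¹)]
    have k₀ : Δ₀ a (-a) u = |a ^ 2 * (u.l 2)⁻¹ - a| := by
      rw [← abs_of_nonneg p₀, ← sq_eq_sq_iff_abs_eq_abs, h₀, hs]; ring
    have k₁ : Δ₁ a (-a) u = |a ^ 2 * (u.l 2)⁻¹ + a| := by
      rw [← abs_of_nonneg p₁, ← sq_eq_sq_iff_abs_eq_abs, h₁, hs]; ring
    -- With `τ = a / l₁z` the cost is `|a| (|τ - 1| + |τ + 1|)`, which equals `2|a|` exactly for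
    -- `|τ| ≤ 1`.
    refine ⟨a / u.l 2, div_ne_zero ha hz, ?_, ?_⟩
    · have := abs_add_le (a ^ 2 * (u.l 2)⁻¹ - a) (a ^ 2 * (u.l 2)⁻¹ + a)
      rw [show a ^ 2 * (u.l 2)⁻¹ - a + (a ^ 2 * (u.l 2)⁻¹ + a) = 2 * a * (a / u.l 2) by
        field_simp; ring, abs_mul, abs_mul, abs_two] at this
      have : 2 * |a| * |a / u.l 2| ≤ 2 * |a| * 1 := by linarith
      exact le_of_mul_le_mul_left this (by positivity)
    · have hd : a / (a / u.l 2) = u.l 2 := by field_simp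
      have h1 := ((isCircTransfer_iff ha hb u).1 hu).1
      ext i
      · fin_cases i
        · exact h1
        · exact hl
        · exact hd.symm
      · fin_cases i
        · exact hs
        · simp only [Fin.mk_one, Matrix.cons_val, hd, hsy]
          ring
        · exact hs2
      · rw [hr]
  · rintro ⟨τ, hτ, hτ1, rfl⟩
    set u : Unknowns := ⟨![0, 0, a / τ], ![0, τ * a - a / τ, 0], ![1, 0, 0]⟩
    have hu : IsCircTransfer a (-a) u := by
      rw [isCircTransfer_iff ha hb]
      refine ⟨rfl, rfl, by simp [u], by simp [u], by simp [u], ?_, ?_, ?_⟩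
      · have : τ ^ 2 ≤ 1 := (sq_le_one_iff_abs_le_one τ).2 hτ1
        have : (a / τ) ^ 2 - (τ * a - a / τ) ^ 2 = a ^ 2 * (2 - τ ^ 2) := by field_simp; ring
        have : 0 < a ^ 2 * (2 - τ ^ 2) := mul_pos (by positivity) (by linarith)
        simp only [u, Matrix.cons_val]
        linarith
      · simp [u]
        field_simp
        ring
      · simp [u]
        field_simp
        ring
    obtain ⟨-, -, -, -, h₀, h₁, -⟩ := coplanar_impulses ha hb hu rfl
    have hi : a ^ 2 * (u.l 2)⁻¹ = a * τ := by simp [u]; field_simp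
    rw [hi] at h₀
    rw [neg_sq, hi] at h₁
    have k₀ : Δ₀ a (-a) u = |a * τ - a| := by
      rw [← abs_of_nonneg (Δ₀_nonneg a _ u), ← sq_eq_sq_iff_abs_eq_abs, h₀]; simp [u]
    have k₁ : Δ₁ a (-a) u = |a * τ - -a| := by
      rw [← abs_of_nonneg (Δ₁_nonneg a _ u), ← sq_eq_sq_iff_abs_eq_abs, h₁]; simp [u]
    refine ⟨hu, rfl, ?_⟩
    rw [abs_le] at hτ1
    rw [f₁_eq, k₀, k₁, show a * τ - a = a * (τ - 1) by ring,
      show a * τ - -a = a * (τ + 1) by ring, abs_mul, abs_mul,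
      abs_of_nonpos (by linarith : τ - 1 ≤ 0), abs_of_nonneg (by linarith : 0 ≤ τ + 1)]
    ring

lemma infinite_adjacent_minimizers (ha : a ≠ 0) :
    {u : Unknowns | IsCircTransfer a (-a) u ∧ u.r = ![1, 0, 0] ∧
      f₁ a (-a) u = 2 * |a|}.Infinite := by
  refine Set.infinite_of_injOn_mapsTo (s := Set.Ioc (0 : ℝ) 1)
    (f := fun τ => ⟨![0, 0, a / τ], ![0, τ * a - a / τ, 0], ![1, 0, 0]⟩) ?_ ?_
    (Set.Ioc_infinite one_pos)
  · intro τ _ τ' _ h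
    have : a / τ = a / τ' := congrFun (congrArg Unknowns.l h) 2
    exact inv_injective (mul_left_cancel₀ ha this)
  · intro τ hτ
    exact (adjacent_minimizer_iff ha _).2
      ⟨τ, hτ.1.ne', by rw [abs_of_pos hτ.1]; exact hτ.2, rfl⟩

/-! ### Non-coplanar critical points with opposite impulses. -/

/-- Singular points are excluded: once `c 3 = c 4 = 0`, the pair `(c 0, c 1 - c 2)` solves a
homogeneous system whose determinant is `ly² + lz²` up to sign, and `c 1 + c 2` is multiplied by `ly
≠ 0`. -/
lemma opposite_linearIndependent {sx sy sz ly lz d₀ d₁ : ℝ} (hl : ly ≠ 0)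
    (hd₀ : d₀ ≠ 0) (hd₁ : d₁ ≠ 0) :
    LinearIndependent ℝ
      (fun i => grad (oppositeEqs a b i) ![sx, sy, sz, ly, lz, d₀, d₁]) := by
  rw [Fintype.linearIndependent_iff]
  intro c hc
  rw [sum_smul_grad_oppositeEqs] at hc
  have e1 := congrFun hc 1
  have e2 := congrFun hc 2
  have e3 := congrFun hc 3
  have e5 := congrFun hc 5
  have e6 := congrFun hc 6
  simp [hd₀, hd₁] at e1 e2 e3 e5 e6
  simp only [e5, e6] at e1 e2 e3
  have hL : ly ^ 2 + lz ^ 2 ≠ 0 := by positivity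
  have c0 : c 0 = 0 := by
    refine (mul_eq_zero.1 (?_ : c 0 * (ly ^ 2 + lz ^ 2) = 0)).resolve_right hL
    linear_combination ly * e1 + lz * e2
  have c12 : c 1 - c 2 = 0 := by
    refine (mul_eq_zero.1 (?_ : (c 1 - c 2) * (ly ^ 2 + lz ^ 2) = 0)).resolve_right hL
    linear_combination lz * e1 - ly * e2
  have c12' : c 1 + c 2 = 0 := by
    rw [c0, c12] at e3
    simpa [hl] using e3
  have c1 : c 1 = 0 := by linarith
  have c2 : c 2 = 0 := by linarith
  intro i
  fin_cases i <;> simp [c0, c1, c2, e5, e6]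

/-- The Lagrange equations of the case of impulses at opposite sides of the centre. -/
lemma opposite_lagrange_iff {σ sx ly lz d₀ d₁ : ℝ} (hl : ly ≠ 0) (hd₀ : 0 < d₀) (hd₁ : 0 < d₁) :
    (∃ c : Fin 5 → ℝ, ![0, 0, 0, 0, 0, 1, 1] =
      ∑ i, c i • grad (oppositeEqs a b i) ![sx, σ * lz, -(σ * ly), ly, lz, d₀, d₁]) ↔
    sx = 0 ∧ a * (1 + σ) * d₁ + b * (1 - σ) * d₀ = 0 := by
  constructor
  · rintro ⟨c, hc⟩
    rw [sum_smul_grad_oppositeEqs] at hc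
    have e0 := congrFun hc 0
    have e1 := congrFun hc 1
    have e2 := congrFun hc 2
    have e3 := congrFun hc 3
    have e4 := congrFun hc 4
    have e5 := congrFun hc 5
    have e6 := congrFun hc 6
    simp only [Matrix.cons_val] at e0 e1 e2 e3 e4 e5 e6
    clear hc
    obtain ⟨p, hp⟩ : ∃ p, p = 2 * c 3 := ⟨_, rfl⟩
    obtain ⟨q, hq⟩ : ∃ q, q = 2 * c 4 := ⟨_, rfl⟩
    rw [← hp] at e1 e2 e3 e4 e5
    rw [← hq] at e1 e2 e3 e4 e6
    have hp0 : 0 < p := pos_of_mul_pos_left (e5 ▸ one_pos) hd₀.le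
    have hq0 : 0 < q := pos_of_mul_pos_left (e6 ▸ one_pos) hd₁.le
    constructor
    · have : (p + q) * sx = 0 := by rw [hp, hq]; linear_combination e0
      exact (mul_eq_zero.1 this).resolve_left (by positivity)
    -- This is the derivative along the rotation of the orbit about the x-axis, which preserves the
    -- first three constraints; hence `c 0, c 1, c 2` drop out.
    · have k : ly * (p * a * (1 + σ) + q * b * (1 - σ)) = 0 := by
        linear_combination lz * e3 - ly * e4 - σ * ly * e1 - σ * lz * e2
      have k' := (mul_eq_zero.1 k).resolve_left hl
      linear_combination d₀ * d₁ * k' + a * (1 + σ) * d₁ * e5 + b * (1 - σ) * d₀ * e6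
  · rintro ⟨rfl, h⟩
    have hL : ly ^ 2 + lz ^ 2 ≠ 0 := by positivity
    have hp : d₀⁻¹ * d₀ = 1 := inv_mul_cancel₀ hd₀.ne'
    have hq : d₁⁻¹ * d₁ = 1 := inv_mul_cancel₀ hd₁.ne'
    generalize d₀⁻¹ = p at *
    generalize d₁⁻¹ = q at *
    have h' : a * (1 + σ) * p + b * (1 - σ) * q = 0 := by
      linear_combination p * q * h - a * (1 + σ) * p * hq - b * (1 - σ) * q * hp
    -- The equations are solved for `c 0 = ly κ`, `c 1 - c 2 = N` and `c 1 + c 2 = M`; the one left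
    -- over, for `l₁z`, is the hypothesis `h'`.
    obtain ⟨κ, hκ⟩ : ∃ κ, κ * (ly ^ 2 + lz ^ 2) = q * b - p * a :=
      ⟨(q * b - p * a) / (ly ^ 2 + lz ^ 2), div_mul_cancel₀ _ hL⟩
    let N := p * (1 + σ) - q * (1 - σ) + lz * κ
    let M := (-σ * lz * κ - σ * N + p * (1 + σ) + q * (1 - σ)) / 2
    refine ⟨![ly * κ, (M + N) / 2, (M - N) / 2, p / 2, q / 2], ?_⟩
    rw [sum_smul_grad_oppositeEqs]
    funext j
    fin_cases j <;> simp only [Fin.reduceFinMk, Fin.zero_eta, Fin.mk_one, Matrix.cons_val, M, N]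
    · ring
    · linear_combination -hκ
    · ring
    · ring
    · linear_combination σ * hκ - h'
    · linear_combination -hp
    · linear_combination -hq

lemma eval_oppositeEqs (a b : ℝ) (h1 : u.l 0 = 0) (hr : u.r = ![-1, 0, 0])
    (h5 : u.l 1 * u.s 1 + u.l 2 * u.s 2 = 0)
    (h7 : a ^ 2 = u.l 1 ^ 2 + u.l 2 ^ 2 + u.s 1 * u.l 2 - u.s 2 * u.l 1)
    (h8 : b ^ 2 = u.l 1 ^ 2 + u.l 2 ^ 2 + (u.s 1 * u.l 2 - u.s 2 * u.l 1) * u.r 0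
        - u.s 0 * u.l 2 * u.r 1) (i : Fin 5) :
    MvPolynomial.eval (oppositePoint a b u) (oppositeEqs a b i) = 0 := by
  have e₀ := Δ₀_sq a b h1
  have e₁ := Δ₁_sq a b h1 (by rw [hr]; rfl)
  simp only [hr, Matrix.cons_val] at h8 e₁
  fin_cases i <;> simp [oppositeEqs, oppositePoint] <;> linarith

/-- Non-coplanar impulses do not vanish. -/
lemma opposite_impulses_pos (ha : a ≠ 0) (hb : b ≠ 0) (hu : IsCircTransfer a b u)
    (hl : u.l 1 ≠ 0) (hr : u.r = ![-1, 0, 0]) : 0 < Δ₀ a b u ∧ 0 < Δ₁ a b u := by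
  obtain ⟨hL, hs₁, hs₂⟩ := opposite_orbit ha hb hu hr
  obtain ⟨h1, h2, -⟩ := (isCircTransfer_iff ha hb u).1 hu
  have e₀ := Δ₀_sq a b h1
  have e₁ := Δ₁_sq a b h1 h2
  simp only [hr, Matrix.cons_val] at e₁
  have hab : a ^ 2 + b ^ 2 ≠ 0 := by positivity
  have k₀ : u.s 2 - u.l 1 ≠ 0 := by
    rw [hs₂, show -((a ^ 2 - b ^ 2) / (a ^ 2 + b ^ 2) * u.l 1) - u.l 1
      = -(2 * a ^ 2 * u.l 1 / (a ^ 2 + b ^ 2)) by field_simp; ring]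
    exact neg_ne_zero.2 (by positivity)
  have k₁ : u.s 2 - u.l 1 * -1 ≠ 0 := by
    rw [hs₂, show -((a ^ 2 - b ^ 2) / (a ^ 2 + b ^ 2) * u.l 1) - u.l 1 * -1
      = 2 * b ^ 2 * u.l 1 / (a ^ 2 + b ^ 2) by field_simp; ring]
    positivity
  constructor
  · refine lt_of_pow_lt_pow_left₀ 2 (Δ₀_nonneg a b u) ?_
    rw [zero_pow two_ne_zero, e₀]; positivity
  · refine lt_of_pow_lt_pow_left₀ 2 (Δ₁_nonneg a b u) ?_
    rw [zero_pow two_ne_zero, e₁]; positivity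

/-- The Lagrange criterion for a given transfer. -/
lemma isOppositeCritical_iff_lagrange (ha : a ≠ 0) (hb : b ≠ 0) (hu : IsCircTransfer a b u)
    (hl : u.l 1 ≠ 0) (hr : u.r = ![-1, 0, 0]) :
    IsOppositeCritical a b u ↔ u.s 0 = 0 ∧ a ^ 3 * Δ₁ a b u + b ^ 3 * Δ₀ a b u = 0 := by
  obtain ⟨-, hs₁, hs₂⟩ := opposite_orbit ha hb hu hr
  obtain ⟨p₀, p₁⟩ := opposite_impulses_pos ha hb hu hl hr
  obtain ⟨h1, -, -, -, h5, -, h7, h8⟩ := (isCircTransfer_iff ha hb u).1 hu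
  have hab : a ^ 2 + b ^ 2 ≠ 0 := by positivity
  have hpt : oppositePoint a b u = ![u.s 0, (a ^ 2 - b ^ 2) / (a ^ 2 + b ^ 2) * u.l 2,
      -((a ^ 2 - b ^ 2) / (a ^ 2 + b ^ 2) * u.l 1), u.l 1, u.l 2, Δ₀ a b u, Δ₁ a b u] := by
    rw [oppositePoint, hs₁, hs₂]
  have key := opposite_lagrange_iff (a := a) (b := b) (σ := (a ^ 2 - b ^ 2) / (a ^ 2 + b ^ 2))
    (sx := u.s 0) (lz := u.l 2) hl p₀ p₁
  have e : a * (1 + (a ^ 2 - b ^ 2) / (a ^ 2 + b ^ 2)) * Δ₁ a b u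
      + b * (1 - (a ^ 2 - b ^ 2) / (a ^ 2 + b ^ 2)) * Δ₀ a b u
      = 2 / (a ^ 2 + b ^ 2) * (a ^ 3 * Δ₁ a b u + b ^ 3 * Δ₀ a b u) := by
    field_simp
    ring
  rw [e, mul_eq_zero, or_iff_right (by positivity)] at key
  rw [← key, ← grad_costPoly (oppositePoint a b u), hpt]
  constructor
  · rintro ⟨-, -, -, -, h | h⟩
    · rw [hpt] at h
      exact absurd (opposite_linearIndependent hl p₀.ne' p₁.ne') h
    · rwa [hpt] at h
  · intro h
    refine ⟨hu, hl, hr, eval_oppositeEqs a b h1 hr h5 h7 h8, .inr ?_⟩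
    rwa [hpt]

lemma sq_add_mul_add_sq_ne_zero (ha : a ≠ 0) : a ^ 2 + a * b + b ^ 2 ≠ 0 := by
  have : 0 < a ^ 2 := by positivity
  nlinarith [sq_nonneg (a + 2 * b)]

lemma mul_oppositeLz (ha : a ≠ 0) (hb : b ≠ 0) :
    4 * a * b * (a ^ 2 + a * b + b ^ 2) * oppositeLz a b =
      a ^ 5 + a ^ 4 * b + 4 * a ^ 3 * b ^ 2 + 4 * a ^ 2 * b ^ 3 + a * b ^ 4 + b ^ 5 := by
  have h := sq_add_mul_add_sq_ne_zero (b := b) ha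
  rw [oppositeLz, mul_comm, div_mul_cancel₀ _ (by positivity)]

/-- The quartic form whose sign decides on the existence of non-coplanar critical points. -/
lemma radicand_mul (ha : a ≠ 0) (hb : b ≠ 0) :
    ((a ^ 2 + b ^ 2) / 2 - oppositeLz a b ^ 2) * (4 * a * b * (a ^ 2 + a * b + b ^ 2)) ^ 2 =
      -((a - b) ^ 2 * ((a ^ 2 + a * b + b ^ 2) ^ 2 + a ^ 2 * b ^ 2) *
        (a ^ 4 + 2 * a ^ 3 * b + 2 * a * b ^ 3 + b ^ 4)) := by
  linear_combination -(4 * a * b * (a ^ 2 + a * b + b ^ 2) * oppositeLz a b +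
    (a ^ 5 + a ^ 4 * b + 4 * a ^ 3 * b ^ 2 + 4 * a ^ 2 * b ^ 3 + a * b ^ 4 + b ^ 5)) *
    mul_oppositeLz ha hb

lemma radicand_pos_iff (ha : a ≠ 0) (hb : b ≠ 0) :
    0 < (a ^ 2 + b ^ 2) / 2 - oppositeLz a b ^ 2 ↔
      a ^ 4 + 2 * a ^ 3 * b + 2 * a * b ^ 3 + b ^ 4 < 0 := by
  have h := sq_add_mul_add_sq_ne_zero (b := b) ha
  have hc : 0 < (4 * a * b * (a ^ 2 + a * b + b ^ 2)) ^ 2 := by positivity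
  rw [← mul_pos_iff_of_pos_right hc, radicand_mul ha hb, neg_pos]
  constructor
  · intro h
    by_contra! h'
    exact h.not_ge (mul_nonneg (by positivity) h')
  · intro h
    have hab : a - b ≠ 0 := by
      rw [sub_ne_zero]
      rintro rfl
      have : 0 < a ^ 4 := by positivity
      nlinarith
    exact mul_neg_of_pos_of_neg (by positivity) h

lemma mul_neg_of_quartic_neg (h : a ^ 4 + 2 * a ^ 3 * b + 2 * a * b ^ 3 + b ^ 4 < 0) :
    a * b < 0 := by
  by_contra! hab
  have : 0 ≤ a * b * (a ^ 2 + b ^ 2) := by positivity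
  have : 0 ≤ a ^ 4 + b ^ 4 := by positivity
  linarith

lemma isOppositeCritical_iff (ha : a ≠ 0) (hb : b ≠ 0) (u : Unknowns) :
    IsOppositeCritical a b u ↔
      u.l 1 ≠ 0 ∧ (u = oppositeSol a b 1 ∨ u = oppositeSol a b (-1)) := by
  have hT := sq_add_mul_add_sq_ne_zero (b := b) ha
  have hab : a ^ 2 + b ^ 2 ≠ 0 := by positivity
  have hlz := mul_oppositeLz ha hb
  constructor
  · intro hc
    obtain ⟨hu, hl, hr, -⟩ := id hc
    refine ⟨hl, ?_⟩
    obtain ⟨hs, hd⟩ := (isOppositeCritical_iff_lagrange ha hb hu hl hr).1 hc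
    obtain ⟨hL, hs₁, hs₂⟩ := opposite_orbit ha hb hu hr
    obtain ⟨p₀, p₁⟩ := opposite_impulses_pos ha hb hu hl hr
    have h1 := ((isCircTransfer_iff ha hb u).1 hu).1
    obtain ⟨h₀, h₁⟩ := opposite_impulses ha h1 hr hL hs₁ hs₂
    have hne : a - b ≠ 0 := by
      rw [sub_ne_zero]
      rintro rfl
      rw [← mul_add] at hd
      exact (mul_ne_zero (pow_ne_zero 3 ha) (by positivity)) hd
    rw [hs] at h₀ h₁
    -- Squaring `a³Δ₁ = -b³Δ₀` and inserting the affine formulas gives a linear equation for `l₁z`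
    -- with leading coefficient proportional to `a³ - b³`.
    have hz : u.l 2 = oppositeLz a b := by
      have hne' : 4 * a * b * (a ^ 2 + a * b + b ^ 2) ≠ 0 := by positivity
      have hM := mul_ne_zero (mul_ne_zero hne hne') (pow_ne_zero 2 (mul_ne_zero ha hb))
      refine mul_left_cancel₀ hM ?_
      linear_combination a ^ 6 * h₁ - b ^ 6 * h₀
        - (a ^ 2 + b ^ 2) * (a ^ 3 * Δ₁ a b u - b ^ 3 * Δ₀ a b u) * hd
        - (a - b) * (a * b) ^ 2 * hlz
    have hy2 : u.l 1 ^ 2 = √((a ^ 2 + b ^ 2) / 2 - oppositeLz a b ^ 2) ^ 2 := by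
      rw [Real.sq_sqrt (by rw [← hz, ← hL]; nlinarith [sq_nonneg (u.l 1)]), ← hz, ← hL]
      ring
    have key : ∀ ε : ℝ, u.l 1 = ε * √((a ^ 2 + b ^ 2) / 2 - oppositeLz a b ^ 2) →
        u = oppositeSol a b ε := by
      intro ε hy
      rw [hy] at hs₂
      rw [hz] at hs₁
      ext i
      · fin_cases i
        · exact h1
        · exact hy
        · exact hz
      · fin_cases i
        · exact hs
        · exact hs₁
        · exact hs₂
      · rw [hr]; rfl
    exact (sq_eq_sq_iff_eq_or_eq_neg.1 hy2).imp (fun h => key 1 (by linarith))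
      (fun h => key (-1) (by linarith))
  · rintro ⟨hl, hsol⟩
    obtain ⟨ε, hε, rfl⟩ : ∃ ε : ℝ, (ε = 1 ∨ ε = -1) ∧ u = oppositeSol a b ε := by
      rcases hsol with h | h
      · exact ⟨1, .inl rfl, h⟩
      · exact ⟨-1, .inr rfl, h⟩
    have he := sq_eq_one_of_sign hε
    -- `√` is `0` on nonpositive numbers, so `l₁y ≠ 0` forces a positive radicand.
    have hR : 0 < (a ^ 2 + b ^ 2) / 2 - oppositeLz a b ^ 2 := by
      by_contra! hR
      exact hl (by simp [oppositeSol, Real.sqrt_eq_zero_of_nonpos hR])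
    have hneg := mul_neg_of_quartic_neg ((radicand_pos_iff ha hb).1 hR)
    have hL : (oppositeSol a b ε).l 1 ^ 2 + (oppositeSol a b ε).l 2 ^ 2 = (a ^ 2 + b ^ 2) / 2 := by
      simp only [oppositeSol, Matrix.cons_val]
      rw [mul_pow, he, Real.sq_sqrt hR.le]; ring
    have hs₀ : (oppositeSol a b ε).s 0 = 0 := rfl
    have hs₁ : (oppositeSol a b ε).s 1 =
      (a ^ 2 - b ^ 2) / (a ^ 2 + b ^ 2) * (oppositeSol a b ε).l 2 := rfl
    have hs₂ : (oppositeSol a b ε).s 2 =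
      -((a ^ 2 - b ^ 2) / (a ^ 2 + b ^ 2) * (oppositeSol a b ε).l 1) := rfl
    have hl0 : (oppositeSol a b ε).l 0 = 0 := rfl
    have hl2 : (oppositeSol a b ε).l 2 = oppositeLz a b := rfl
    have hr : (oppositeSol a b ε).r = ![-1, 0, 0] := rfl
    generalize oppositeSol a b ε = u at *
    have hu : IsCircTransfer a b u := by
      rw [isCircTransfer_iff ha hb, hs₀, hs₁, hs₂, hr]
      simp only [Matrix.cons_val]
      refine ⟨hl0, trivial, by ring, by ring, by ring, ?_, ?_, ?_⟩
      · have : ((a ^ 2 - b ^ 2) / (a ^ 2 + b ^ 2)) ^ 2 < 1 := by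
          rw [div_pow, div_lt_one (by positivity)]
          have : 0 < a ^ 2 * b ^ 2 := by positivity
          linarith
        have hp : 0 < u.l 1 ^ 2 + u.l 2 ^ 2 := by positivity
        linear_combination (u.l 1 ^ 2 + u.l 2 ^ 2) * this
      · have : a ^ 2 = (u.l 1 ^ 2 + u.l 2 ^ 2) * (1 + (a ^ 2 - b ^ 2) / (a ^ 2 + b ^ 2)) := by
          rw [hL]; field_simp; ring
        linear_combination this
      · have : b ^ 2 = (u.l 1 ^ 2 + u.l 2 ^ 2) * (1 - (a ^ 2 - b ^ 2) / (a ^ 2 + b ^ 2)) := by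
          rw [hL]; field_simp; ring
        linear_combination this
    refine (isOppositeCritical_iff_lagrange ha hb hu hl hr).2 ⟨hs₀, ?_⟩
    obtain ⟨p₀, p₁⟩ := opposite_impulses_pos ha hb hu hl hr
    obtain ⟨h₀, h₁⟩ := opposite_impulses ha hl0 hr hL hs₁ hs₂
    rw [hs₀, hl2] at h₀ h₁
    have hsq : (a ^ 3 * Δ₁ a b u) ^ 2 = (b ^ 3 * Δ₀ a b u) ^ 2 := by
      refine mul_left_cancel₀ hab ?_
      linear_combination a ^ 6 * h₁ - b ^ 6 * h₀ - (a - b) * (a * b) ^ 2 * hlz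
    -- Squaring lost a sign: `a³Δ₁ = b³Δ₀` is impossible because `a b < 0` and the impulses are
    -- positive.
    rcases sq_eq_sq_iff_eq_or_eq_neg.1 hsq with h | h
    · exfalso
      have : (a * b) ^ 3 * (Δ₀ a b u * Δ₁ a b u) < 0 :=
        mul_neg_of_neg_of_pos (Odd.pow_neg (by decide) hneg) (by positivity)
      have : 0 ≤ (a ^ 3 * Δ₁ a b u) ^ 2 := sq_nonneg _
      nlinarith
    · rw [h]; ring

/-! ### The quartic and the range of `b / a`. -/

/-- A factorization of the quartic. -/
lemma quartic_eq_mul (t : ℝ) : t ^ 4 + 2 * t ^ 3 + 2 * t + 1 =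
    (t - (-(1 + √3) - √(2 * √3)) / 2) * (t - (-(1 + √3) + √(2 * √3)) / 2) *
      (t ^ 2 + (1 - √3) * t + 1) := by
  -- The quartic is palindromic: with `s = t + 1/t` it is `t² (s² + 2s - 2)`, and `s = -1 ± √3`
  -- gives the factors `t² + (1 ± √3) t + 1`, of discriminant `±2√3`.
  have h3 : √3 ^ 2 = 3 := Real.sq_sqrt (by norm_num)
  have h : √(2 * √3) ^ 2 = 2 * √3 := Real.sq_sqrt (by positivity)
  have e : (t - (-(1 + √3) - √(2 * √3)) / 2) * (t - (-(1 + √3) + √(2 * √3)) / 2) =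
      t ^ 2 + (1 + √3) * t + 1 := by
    linear_combination -h / 4 + h3 / 4
  rw [e]
  linear_combination t ^ 2 * h3

lemma quartic_factor_pos (t : ℝ) : 0 < t ^ 2 + (1 - √3) * t + 1 := by
  have h3 : √3 ^ 2 = 3 := Real.sq_sqrt (by norm_num)
  have : 0 < √3 := by positivity
  nlinarith [sq_nonneg (t + (1 - √3) / 2)]

lemma exists_oppositeCritical_iff (ha : a ≠ 0) (hb : b ≠ 0) :
    (∃ u, IsOppositeCritical a b u) ↔ 0 < (a ^ 2 + b ^ 2) / 2 - oppositeLz a b ^ 2 := by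
  simp only [isOppositeCritical_iff ha hb]
  constructor
  · rintro ⟨u, hl, rfl | rfl⟩ <;>
    · by_contra! hR
      exact hl (by simp [oppositeSol, Real.sqrt_eq_zero_of_nonpos hR])
  · intro hR
    refine ⟨oppositeSol a b 1, ?_, .inl rfl⟩
    simpa [oppositeSol] using (Real.sqrt_pos.2 hR).ne'

lemma opposite_range (ha : a ≠ 0) (hb : b ≠ 0) :
    ∃ a₁ a₂ : ℝ, a₁ < a₂ ∧ a₂ < 0 ∧
      {t : ℝ | t ^ 4 + 2 * t ^ 3 + 2 * t + 1 = 0} = {a₁, a₂} ∧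
      ((∃ u : Unknowns, IsOppositeCritical a b u) ↔ a₁ < b / a ∧ b / a < a₂) ∧
      (a₁ < b / a → b / a < a₂ → 0 < (a ^ 2 + b ^ 2) / 2 - oppositeLz a b ^ 2) := by
  have h3 : 0 < √3 := by positivity
  have hs : 0 < √(2 * √3) := by positivity
  have key : 0 < (a ^ 2 + b ^ 2) / 2 - oppositeLz a b ^ 2 ↔
      (-(1 + √3) - √(2 * √3)) / 2 < b / a ∧ b / a < (-(1 + √3) + √(2 * √3)) / 2 := by
    -- The quartic form is homogeneous, so its sign depends only on `t = b / a`.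
    have e : a ^ 4 + 2 * a ^ 3 * b + 2 * a * b ^ 3 + b ^ 4 =
        a ^ 4 * ((b / a) ^ 4 + 2 * (b / a) ^ 3 + 2 * (b / a) + 1) := by field_simp; ring
    rw [radicand_pos_iff ha hb, e, quartic_eq_mul]
    generalize b / a = t
    have hq := quartic_factor_pos t
    have ha4 : 0 < a ^ 4 := by positivity
    rw [mul_left_comm, ← neg_pos, ← neg_mul, mul_pos_iff_of_pos_right (mul_pos ha4 hq), neg_pos,
      mul_neg_iff]
    constructor
    · rintro (⟨h, h'⟩ | ⟨h, h'⟩)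
      · exact ⟨by linarith, by linarith⟩
      · linarith
    · rintro ⟨h, h'⟩
      exact .inl ⟨by linarith, by linarith⟩
  refine ⟨(-(1 + √3) - √(2 * √3)) / 2, (-(1 + √3) + √(2 * √3)) / 2, by linarith, ?_, ?_, ?_,
    fun h h' => key.2 ⟨h, h'⟩⟩
  · have : √(2 * √3) < 1 + √3 := by
      rw [Real.sqrt_lt' (by positivity)]
      nlinarith
    linarith
  · ext t
    rw [Set.mem_ofPred_eq, quartic_eq_mul, mul_eq_zero, mul_eq_zero, sub_eq_zero, sub_eq_zero,
      or_iff_left (quartic_factor_pos t).ne', Set.mem_insert_iff, Set.mem_singleton_iff]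
  · rw [exists_oppositeCritical_iff ha hb, key]

end OrbitTransfer

open OrbitTransfer in
theorem mainTheorem1 (a b : ℝ) (ha : a ≠ 0) (hb : b ≠ 0) :
    -- the two cases: coplanar, or the impulses are applied on the `x`-axis
    (∀ u : Unknowns, IsCircTransfer a b u →
      u.l 0 = 0 ∧ u.r 2 = 0 ∧ u.l 1 * u.r 1 = 0 ∧
      (u.l 1 = 0 → u.s 2 = 0) ∧
      (u.l 1 ≠ 0 → u.r = ![1, 0, 0] ∨ u.r = ![-1, 0, 0]) ∧
      (u.l 1 ≠ 0 → u.r = ![1, 0, 0] → a ^ 2 = b ^ 2)) ∧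
    -- the coplanar critical points (circles of different radii)
    (a ^ 2 ≠ b ^ 2 → ∀ u : Unknowns,
      IsCoplanarCritical a b u ↔ u = hohmann a b 1 ∨ u = hohmann a b (-1)) ∧
    -- both candidates are transfers; their cost
    (∀ ε : ℝ, ε = 1 ∨ ε = -1 →
      IsCircTransfer a b (hohmann a b ε) ∧ f₁ a b (hohmann a b ε) = hohmannCost a b ε) ∧
    -- the Hohmann transfer, with the sign of `a + b`, is optimal among all transfers
    (∀ ε : ℝ, ε = 1 ∨ ε = -1 → 0 ≤ ε * (a + b) →
      IsMinOn (f₁ a b) {u | IsCircTransfer a b u} (hohmann a b ε) ∧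
      (a ^ 2 ≠ b ^ 2 → ∀ u : Unknowns, IsCircTransfer a b u →
        f₁ a b u = f₁ a b (hohmann a b ε) → u = hohmann a b ε) ∧
      (∀ u : Unknowns, IsCircTransfer a b u → u.l 1 ≠ 0 → hohmannCost a b ε < f₁ a b u)) ∧
    -- the wrong sign is not optimal
    (∀ ε : ℝ, ε = 1 ∨ ε = -1 → 0 < ε * (a + b) → hohmannCost a b ε < hohmannCost a b (-ε)) ∧
    -- the non-coplanar critical points with impulses at opposite sides of the centre
    (∀ u : Unknowns, IsOppositeCritical a b u ↔
      u.l 1 ≠ 0 ∧ (u = oppositeSol a b 1 ∨ u = oppositeSol a b (-1))) ∧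
    (∃ a₁ a₂ : ℝ, a₁ < a₂ ∧ a₂ < 0 ∧
      {t : ℝ | t ^ 4 + 2 * t ^ 3 + 2 * t + 1 = 0} = {a₁, a₂} ∧
      ((∃ u : Unknowns, IsOppositeCritical a b u) ↔ a₁ < b / a ∧ b / a < a₂) ∧
      (a₁ < b / a → b / a < a₂ → 0 < (a ^ 2 + b ^ 2) / 2 - oppositeLz a b ^ 2)) ∧
    -- circles of the same radius
    (a = b → ∀ ε : ℝ, ε = 1 ∨ ε = -1 → 0 ≤ ε * (a + b) → f₁ a b (hohmann a b ε) = 0) ∧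
    (a = -b →
      (∀ u : Unknowns, IsCircTransfer a b u → 2 * |a| ≤ f₁ a b u) ∧
      {u : Unknowns | IsCircTransfer a b u ∧ u.r = ![1, 0, 0] ∧ f₁ a b u = 2 * |a|}.Infinite ∧
      (∀ u : Unknowns, IsCircTransfer a b u ∧ u.r = ![1, 0, 0] ∧ f₁ a b u = 2 * |a| ↔
        ∃ τ : ℝ, τ ≠ 0 ∧ |τ| ≤ 1 ∧
          u = ⟨![0, 0, a / τ], ![0, τ * a - a / τ, 0], ![1, 0, 0]⟩)) := by
  refine ⟨fun u hu => isCircTransfer_cases ha hb hu,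
    fun hab u => isCoplanarCritical_iff ha hb hab u,
    fun ε hε => ⟨isCircTransfer_hohmann ha hb hε, f₁_hohmann ha hb hε⟩,
    fun ε hε hab => ⟨?_, ?_, ?_⟩, ?_, isOppositeCritical_iff ha hb, opposite_range ha hb, ?_, ?_⟩
  · intro u hu
    rw [Set.mem_ofPred_eq, f₁_hohmann ha hb hε]
    exact hohmannCost_le ha hb hε hab hu
  · intro hab2 u hu hf
    exact eq_hohmann_of_f₁_eq ha hb hε hab hab2 hu (hf.trans (f₁_hohmann ha hb hε))
  · exact fun u hu hl => hohmannCost_lt_of_noncoplanar ha hb hε hab hu hl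
  · intro ε hε hab
    rw [hohmannCost_eq, hohmannCost_eq, hohmannInv_neg]
    exact (hohmann_sign (hohmannInv_mul_nonneg hab.le) (hohmannInv_sq ha hε)).2
      (hohmannInv_mul_pos ha hab)
  · rintro rfl ε hε hab
    rw [f₁_hohmann ha ha hε, hohmannCost_self ha hε hab]
  · intro hab
    obtain rfl : b = -a := by linarith
    refine ⟨fun u hu => ?_, infinite_adjacent_minimizers ha, adjacent_minimizer_iff ha⟩
    rw [← hohmannCost_neg_self ha (.inl rfl)]
    exact hohmannCost_le ha hb (.inl rfl) (by simp) hu
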